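/- Let $T>0$, $m\ge 1$, $H\in(1/2,1)$, $\alpha\in(0,H)$ and $\gamma\in(0,2H-1)$ with $\rho:=\alpha-\gamma>0$. Let $\mathcal A_N=\{(\eta_k,\zeta_k):1\le k\le N\}$ be a finite family of exponents in $[0,1]$ such that $0\le\zeta_k\le\min(\rho,\eta_k)$ and $\eta_k>1-\alpha$ for every $k$. Let $B=(B^1,\dots,B^m)$ be a fractional Brownian motion on $[0,T]$ with Hurst parameter $H$, i.e. a centered Gaussian process with independent coordinates, each with covariance $R(s,t)=\frac12(t^{2H}+s^{2H}-|t-s|^{2H})$. Let $\mathcal H$ be the completion of the step functions on $[0,T]$ for the inner product $\langle f,g\rangle_{\mathcal H}=H(2H-1)\int_0^T\int_0^T f(u)g(v)|u-v|^{2H-2}\,du\,dv$, and let $h\mapsto B^i(h)$ (the Wiener integral) be the linear isometry from $\mathcal H$ into $L^2(\Omega)$ that extends $\mathbf 1_{[0,t]}\mapsto B^i_t$. Write $\Delta_3=\{0\le s<t<\tau\le T\}$ and $\Delta_4=\{0\le s<t<\tau'<\tau\le T\}$ and, for $(s,t,\tau)\in\Delta_3$, $$\mathbf z^{1,\tau,i}_{ts}=\int_s^t(\tau-r)^{-\gamma}\,dB^i_r:=B^i\big(r\mapsto(\tau-r)^{-\gamma}\mathbf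 1_{[s,t]}(r)\big),\qquad 1\le i\le m .$$ For $z:\Delta_3\to\mathbb R^m$, $(s,t,\tau)\mapsto z^\tau_{ts}$, put $\|z\|_{(\alpha,\gamma,\eta,\zeta)}=\|z\|_{(\alpha,\gamma),1}+\|z\|_{(\alpha,\gamma,\eta,\zeta),1,2}$, where $$\|z\|_{(\alpha,\gamma),1}=\sup_{(s,t,\tau)\in\Delta_3}\frac{|z^\tau_{ts}|}{\big[|\tau-t|^{-\gamma}|t-s|^{\alpha}\big]\wedge|t-s|^{\rho}},$$ $$\|z\|_{(\alpha,\gamma,\eta,\zeta),1,2}=\sup_{(s,t,\tau',\tau)\in\Delta_4}\frac{|z^{\tau}_{ts}-z^{\tau'}_{ts}|}{|\tau-\tau'|^{\eta}|\tau'-t|^{-(\eta-\zeta)}\Big(\big[|\tau'-t|^{-\gamma-\zeta}|t-s|^{\alpha}\big]\wedge|t-s|^{\rho-\zeta}\Big)},$$ and let $\mathcal V^{(\alpha,\gamma,\eta,\zeta)}(\Delta_3;\mathbb R^m)$ be the set of all $z$ with $\|z\|_{(\alpha,\gamma,\eta,\zeta)}<\infty$. Then the family $\mathbf z^{1}=(\mathbf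 z^{1,\tau}_{ts})_{(s,t,\tau)\in\Delta_3}$ has a version with almost surely continuous paths on $\Delta_3$, and for every such version, almost surely, $\mathbf z^1\in\mathcal V^{(\alpha,\gamma,\eta,\zeta)}(\Delta_3;\mathbb R^m)$ for all $(\eta,\zeta)\in\mathcal A_N$. Moreover, for all $(\eta,\zeta)\in\mathcal A_N$, the norm $\|\mathbf z^1\|_{(\alpha,\gamma,\eta,\zeta)}$ is measurable (with respect to the completed $\sigma$-algebra) and, for all real $p\ge1$, $$\mathbb E\big[\|\mathbf z^{1}\|_{(\alpha,\gamma,\eta,\zeta)}^{2p}\big]<\infty .$$ -/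

import Mathlib

open MeasureTheory ProbabilityTheory Filter Topology
open scoped ENNReal

noncomputable section

namespace VolterraFBM

/-! ### Volterra spaces -/

/-- The simplex `Δ₃ = {(s, t, τ) : 0 ≤ s < t < τ ≤ T}`. -/
def simplex3 (T : ℝ) : Set (ℝ × ℝ × ℝ) :=
  {x | 0 ≤ x.1 ∧ x.1 < x.2.1 ∧ x.2.1 < x.2.2 ∧ x.2.2 ≤ T}

/-- The simplex `Δ₄ = {(s, t, τ', τ) : 0 ≤ s < t < τ' < τ ≤ T}`. -/
def simplex4 (T : ℝ) : Set (ℝ × ℝ × ℝ × ℝ) :=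
  {x | 0 ≤ x.1 ∧ x.1 < x.2.1 ∧ x.2.1 < x.2.2.1 ∧ x.2.2.1 < x.2.2.2 ∧ x.2.2.2 ≤ T}

/-- `ψ¹_{(α,γ)}(τ,t,s) = [|τ-t|^{-γ} |t-s|^α] ∧ |t-s|^{α-γ}`. -/
def psi1 (α γ τ t s : ℝ) : ℝ :=
  min (|τ - t| ^ (-γ) * |t - s| ^ α) (|t - s| ^ (α - γ))

/-- `ψ^{1,2}_{(α,γ,η,ζ)}(τ,τ',t,s)
  = |τ-τ'|^η |τ'-t|^{-(η-ζ)} ([|τ'-t|^{-γ-ζ} |t-s|^α] ∧ |t-s|^{α-γ-ζ})`. -/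
def psi12 (α γ η ζ τ τ' t s : ℝ) : ℝ :=
  |τ - τ'| ^ η * |τ' - t| ^ (-(η - ζ)) *
    min (|τ' - t| ^ (-γ - ζ) * |t - s| ^ α) (|t - s| ^ (α - γ - ζ))

/-- The `1`-norm of an increment `z s t τ = z^τ_{ts}` on `Δ₃`, as an extended nonnegative real. -/
def volterraNorm1 {E : Type*} [NormedAddCommGroup E] (T α γ : ℝ) (z : ℝ → ℝ → ℝ → E) : ℝ≥0∞ :=
  ⨆ x ∈ simplex3 T, ‖z x.1 x.2.1 x.2.2‖ₑ / ENNReal.ofReal (psi1 α γ x.2.2 x.2.1 x.1)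

/-- The `(1,2)`-norm: the supremum over `(s, t, τ', τ) ∈ Δ₄` of
`|z^τ_{ts} - z^{τ'}_{ts}| / ψ^{1,2}(τ,τ',t,s)`. -/
def volterraNorm12 {E : Type*} [NormedAddCommGroup E] (T α γ η ζ : ℝ)
    (z : ℝ → ℝ → ℝ → E) : ℝ≥0∞ :=
  ⨆ x ∈ simplex4 T, ‖z x.1 x.2.1 x.2.2.2 - z x.1 x.2.1 x.2.2.1‖ₑ /
    ENNReal.ofReal (psi12 α γ η ζ x.2.2.2 x.2.2.1 x.2.1 x.1)

/-- The Volterra norm `‖z‖_{(α,γ,η,ζ)}`. -/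
def volterraNorm {E : Type*} [NormedAddCommGroup E] (T α γ η ζ : ℝ)
    (z : ℝ → ℝ → ℝ → E) : ℝ≥0∞ :=
  volterraNorm1 T α γ z + volterraNorm12 T α γ η ζ z

/-- The Volterra space `𝒱^{(α,γ,η,ζ)}(Δ₃; E)` of increments with finite Volterra norm
(only the values on `Δ₃` matter). -/
def volterraSpace (E : Type*) [NormedAddCommGroup E] (T α γ η ζ : ℝ) :
    Set (ℝ → ℝ → ℝ → E) :=
  {z | volterraNorm T α γ η ζ z < ∞}

/-! ### Fractional Brownian motion and its Wiener integral -/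

/-- `B` is a standard `m`-dimensional fractional Brownian motion on `[0,T]` with Hurst parameter
`H`: a centered Gaussian process with independent coordinates, each of which has covariance
`R(s,t) = (t^{2H} + s^{2H} - |t-s|^{2H}) / 2`. -/
structure IsFBM {Ω : Type*} [MeasurableSpace Ω] (P : Measure Ω) (H T : ℝ) {m : ℕ}
    (B : Set.Icc (0 : ℝ) T → Ω → EuclideanSpace ℝ (Fin m)) : Prop where
  gaussian : IsGaussianProcess B P
  centered : ∀ t i, ∫ ω, B t ω i ∂P = 0
  indep : iIndepFun (fun (i : Fin m) (ω : Ω) (t : Set.Icc (0 : ℝ) T) => B t ω i) P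
  covariance : ∀ s t i, cov[fun ω => B s ω i, fun ω => B t ω i; P] =
    (|(t : ℝ)| ^ (2 * H) + |(s : ℝ)| ^ (2 * H) - |(t : ℝ) - (s : ℝ)| ^ (2 * H)) / 2

/-- The step function `∑ₜ cₜ 1_{[0,t]}` with finitely many nonzero coefficients. -/
def stepFun {T : ℝ} (c : Set.Icc (0 : ℝ) T →₀ ℝ) (r : ℝ) : ℝ :=
  c.sum fun t a => a * (Set.Icc (0 : ℝ) t).indicator (fun _ => (1 : ℝ)) r

/-- The Wiener integral `∑ₜ cₜ b_t` of the step function `∑ₜ cₜ 1_{[0,t]}`. -/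
def stepIntegral {Ω : Type*} {T : ℝ} (b : Set.Icc (0 : ℝ) T → Ω → ℝ)
    (c : Set.Icc (0 : ℝ) T →₀ ℝ) (ω : Ω) : ℝ :=
  c.sum fun t a => a * b t ω

/-- The inner product
`⟨f, g⟩_ℋ = H (2H - 1) ∫₀ᵀ ∫₀ᵀ f(u) g(v) |u - v|^{2H - 2} du dv`. -/
def innerH (H T : ℝ) (f g : ℝ → ℝ) : ℝ :=
  H * (2 * H - 1) * ∫ v in Set.Icc 0 T, ∫ u in Set.Icc 0 T, f u * g v * |u - v| ^ (2 * H - 2)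

/-- The space `|ℋ|` of measurable functions on `[0,T]` for which the double integral
defining `⟨f, f⟩_ℋ` converges absolutely. -/
def MemAbsH (H T : ℝ) (f : ℝ → ℝ) : Prop :=
  AEMeasurable f (volume.restrict (Set.Icc 0 T)) ∧
    ∫⁻ v in Set.Icc 0 T, ∫⁻ u in Set.Icc 0 T,
      ENNReal.ofReal (|f u| * |f v| * |u - v| ^ (2 * H - 2)) < ∞

/-- `X` is (a representative of) the Wiener integral `b(h)` of a function `h ∈ |ℋ| ⊆ ℋ`: the image
of `h` under the extension of `1_{[0,t]} ↦ b_t` to an isometry from the completion `ℋ` of the step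
functions into `L²(Ω)`. That is, `X` is the `L²(Ω)`-limit of the integrals of step functions which
converge to `h` in the norm of `ℋ`. -/
def IsWienerIntegral {Ω : Type*} [MeasurableSpace Ω] (P : Measure Ω) (H T : ℝ)
    (b : Set.Icc (0 : ℝ) T → Ω → ℝ) (h : ℝ → ℝ) (X : Ω → ℝ) : Prop :=
  MemAbsH H T h ∧ MemLp X 2 P ∧ ∃ c : ℕ → (Set.Icc (0 : ℝ) T →₀ ℝ),
    Tendsto (fun n => innerH H T (h - stepFun (c n)) (h - stepFun (c n))) atTop (𝓝 0) ∧
    Tendsto (fun n => eLpNorm (X - stepIntegral b (c n)) 2 P) atTop (𝓝 0)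

/-- `h^τ_{ts}(r) = (τ - r)^{-γ} 1_{[s,t]}(r)`. -/
def kernel (γ s t τ : ℝ) : ℝ → ℝ :=
  (Set.Icc s t).indicator fun r => (τ - r) ^ (-γ)

/-- `z` is a version, with almost surely continuous paths on `Δ₃`, of the first level
`z^{1,τ,i}_{ts} = ∫_s^t (τ - r)^{-γ} dB^i_r`, `(s,t,τ) ∈ Δ₃`, where for each fixed `(s,t,τ)` the
integral is a Wiener integral (hence determined up to a null set). -/
structure IsFirstLevel {Ω : Type*} [MeasurableSpace Ω] (P : Measure Ω) (H T γ : ℝ) {m : ℕ}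
    (B : Set.Icc (0 : ℝ) T → Ω → EuclideanSpace ℝ (Fin m))
    (z : Ω → ℝ → ℝ → ℝ → EuclideanSpace ℝ (Fin m)) : Prop where
  wiener : ∀ s t τ, (s, t, τ) ∈ simplex3 T → ∀ i,
    IsWienerIntegral P H T (fun r ω => B r ω i) (kernel γ s t τ) (fun ω => z ω s t τ i)
  continuous : ∀ᵐ ω ∂P,
    ContinuousOn (fun x : ℝ × ℝ × ℝ => z ω x.1 x.2.1 x.2.2) (simplex3 T)

end VolterraFBM

end

/-! All randomness is pushed into one Hölder constant per coordinate. Fix `a` strictly between `α`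
and `H`. Kolmogorov's criterion (`exists_holder_version`) gives each coordinate of `B` a version `x`
that is `a`-Hölder with a constant `K` having moments of all orders. Integration by parts then
defines `∫ (τ-r)^{-γ} dx_r` path by path, for all `(s,t,τ)` at once (`pathIntegral`), so no
continuity criterion in several parameters is needed.

Regrouped as `(τ-s)^{-γ}(x_t-x_s) + ∫ γ(τ-r)^{-γ-1}(x_t-x_r) dr`, the integral is at most a constant
times `K ψ¹`: the singularity at `τ = t` is compensated by `|x_t-x_r| ≤ K(t-r)^a`. A difference in
`τ` has the same shape with differenced kernels. Interpolating these (`rpow_neg_sub_rpow_neg_le`)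
extracts `(τ-τ')^η` and raises the singularity from `γ` to at most `γ+ζ ≤ α < a`, so the same
estimate `abs_young_le` applies. Hence the Volterra norm is at most a constant times the sum of the
`K i`.

It remains to see that every continuous version of the Wiener integral is this pathwise one.
Left-point Riemann sums are integrals of step functions. These tend to the kernel uniformly almost
everywhere, hence in the norm of `ℋ`, and their integrals tend to the pathwise integral in `L²` with
error proportional to `K` (`isWienerIntegral_pathIntegral`). The Wiener integral is unique almost
surely (`IsWienerIntegral.ae_eq`); a countable dense set of triples and continuity make two versions
indistinguishable (`IsFirstLevel.ae_eq`). The same density argument reduces the norm to countable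
suprema and gives its measurability. -/

namespace VolterraFBM

/-! ### Estimates for power kernels -/

/-- Scaling by `a` reduces this to `1 - (1+x)^{-p} ≤ max 1 p * x^η` for `x = d/a`. If `x ≤ 1`, the
left side is at most `p x ≤ p x^η`; if `x ≥ 1`, it is at most `1 ≤ x^η`. -/
lemma rpow_neg_sub_rpow_neg_le {a d p η : ℝ} (ha : 0 < a) (hd : 0 < d) (hp : 0 < p)
    (hη0 : 0 ≤ η) (hη1 : η ≤ 1) :
    a ^ (-p) - (a + d) ^ (-p) ≤ max 1 p * (d ^ η * a ^ (-p - η)) := by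
  have hx : 0 < d / a := div_pos hd ha
  have h1 : (a + d) ^ (-p) = a ^ (-p) * (1 + d / a) ^ (-p) := by
    rw [← Real.mul_rpow ha.le (by positivity)]
    congr 1
    field_simp
  have h2 : d ^ η * a ^ (-p - η) = a ^ (-p) * (d / a) ^ η := by
    rw [Real.div_rpow hd.le ha.le, Real.rpow_sub ha]
    ring
  have h3 : 1 - p * (d / a) ≤ (1 + d / a) ^ (-p) := by
    rw [Real.rpow_def_of_pos (by positivity)]
    have hl : Real.log (1 + d / a) ≤ d / a := by
      have := Real.log_le_sub_one_of_pos (show 0 < 1 + d / a by positivity)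
      linarith
    have he := Real.add_one_le_exp (Real.log (1 + d / a) * -p)
    nlinarith
  have h4 : 0 < (1 + d / a) ^ (-p) := by positivity
  have h5 : 1 - (1 + d / a) ^ (-p) ≤ max 1 p * (d / a) ^ η := by
    have hm1 : (1 : ℝ) ≤ max 1 p := le_max_left _ _
    have hm2 : p ≤ max 1 p := le_max_right _ _
    rcases le_total (d / a) 1 with h | h
    · have : (d / a) ≤ (d / a) ^ η := by
        simpa using Real.rpow_le_rpow_of_exponent_ge hx h hη1
      nlinarith
    · have : 1 ≤ (d / a) ^ η := Real.one_le_rpow h hη0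
      nlinarith
  rw [h1, h2]
  have : 0 < a ^ (-p) := by positivity
  nlinarith

/-- The two competing bounds `(σ-t)^{-q} (t-s)^α` and `(t-s)^{α-q}`. -/
noncomputable def kernelBound (α q σ t s : ℝ) : ℝ :=
  min ((σ - t) ^ (-q) * (t - s) ^ α) ((t - s) ^ (α - q))

lemma rpow_le_mul_rpow_of_le {x T a α : ℝ} (hx : 0 < x) (hxT : x ≤ T) (h : α ≤ a) :
    x ^ a ≤ T ^ (a - α) * x ^ α := by
  have : x ^ a = x ^ (a - α) * x ^ α := by rw [← Real.rpow_add hx]; ring_nf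
  rw [this]
  gcongr

/-- Since `σ-s` dominates both `σ-t` and `t-s`, its negative power is bounded by that of either one;
the two choices give the two entries of the minimum. -/
lemma boundary_le_kernelBound {s t σ T q α a : ℝ} (hst : s < t) (htσ : t < σ) (hT : t - s ≤ T)
    (hq : 0 < q) (hαa : α ≤ a) :
    (σ - s) ^ (-q) * (t - s) ^ a ≤ T ^ (a - α) * kernelBound α q σ t s := by
  have hts : 0 < t - s := sub_pos.2 hst
  have hTp : 0 < T := hts.trans_le hT
  have h1 := rpow_le_mul_rpow_of_le hts hT hαa
  rw [kernelBound, mul_min_of_nonneg _ _ (by positivity)]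
  have h3 : 0 < σ - t := sub_pos.2 htσ
  refine le_min ?_ ?_
  · calc (σ - s) ^ (-q) * (t - s) ^ a ≤ (σ - t) ^ (-q) * (T ^ (a - α) * (t - s) ^ α) := by
          refine mul_le_mul ?_ h1 (by positivity) (by positivity)
          exact Real.rpow_le_rpow_of_nonpos h3 (by linarith) (by linarith)
      _ = _ := by ring
  · calc (σ - s) ^ (-q) * (t - s) ^ a ≤ (t - s) ^ (-q) * (T ^ (a - α) * (t - s) ^ α) := by
          refine mul_le_mul ?_ h1 (by positivity) (by positivity)
          exact Real.rpow_le_rpow_of_nonpos hts (by linarith) (by linarith)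
      _ = _ := by rw [sub_eq_add_neg α q, Real.rpow_add hts]; ring

lemma hasDerivAt_rpow_sub {σ r p : ℝ} (h : r < σ) :
    HasDerivAt (fun r => (σ - r) ^ p) (-p * (σ - r) ^ (p - 1)) r := by
  have h1 : HasDerivAt (fun r => σ - r) (-1) r := by
    simpa using (hasDerivAt_id r).const_sub σ
  have := h1.rpow_const (p := p) (Or.inl (sub_pos.2 h).ne')
  convert this using 1
  ring

lemma continuousOn_rpow_sub {s t σ p : ℝ} (htσ : t < σ) (hst : s ≤ t) :
    ContinuousOn (fun r => (σ - r) ^ p) (Set.uIcc s t) := by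
  rw [Set.uIcc_of_le hst]
  intro r hr
  exact (hasDerivAt_rpow_sub (hr.2.trans_lt htσ)).continuousAt.continuousWithinAt

lemma integral_rpow_sub {s t σ q : ℝ} (hst : s ≤ t) (htσ : t < σ) :
    ∫ r in s..t, q * (σ - r) ^ (-q - 1) = (σ - t) ^ (-q) - (σ - s) ^ (-q) := by
  rw [intervalIntegral.integral_eq_sub_of_hasDerivAt (f := fun r => (σ - r) ^ (-q))]
  · intro r hr
    rw [Set.uIcc_of_le hst] at hr
    simpa using hasDerivAt_rpow_sub (p := -q) (hr.2.trans_lt htσ)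
  · exact (continuousOn_const.mul (continuousOn_rpow_sub htσ hst)).intervalIntegrable

lemma continuous_sub_rpow {t a : ℝ} (ha : 0 ≤ a) : Continuous fun r : ℝ => (t - r) ^ a :=
  (continuous_const.sub continuous_id).rpow_const fun _ => Or.inr ha

lemma intervalIntegrable_kernel {s t σ q a : ℝ} (hst : s ≤ t) (htσ : t < σ) (ha : 0 ≤ a) :
    IntervalIntegrable (fun r => (σ - r) ^ (-q - 1) * (t - r) ^ a) volume s t :=
  ((continuousOn_rpow_sub htσ hst).mul (continuous_sub_rpow ha).continuousOn).intervalIntegrable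

/-- For the first entry of the minimum, freeze `(t-r)^a ≤ (t-s)^a` and integrate the kernel exactly,
which costs `1/q`. For the second, use `σ-r ≥ t-r` to reach `∫ (t-r)^{a-q-1}`, which converges
because `q < a` and costs `1/(a-q)`. -/
lemma integral_le_kernelBound {s t σ T q α a : ℝ} (hst : s < t) (htσ : t < σ) (hT : t - s ≤ T)
    (hq : 0 < q) (hqa : q < a) (hαa : α ≤ a) :
    ∫ r in s..t, (σ - r) ^ (-q - 1) * (t - r) ^ a ≤
      (1 / q + 1 / (a - q)) * T ^ (a - α) * kernelBound α q σ t s := by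
  have hts : 0 < t - s := sub_pos.2 hst
  have hTp : 0 < T := hts.trans_le hT
  have ha : 0 < a := hq.trans hqa
  have h1 := rpow_le_mul_rpow_of_le hts hT hαa
  have h3 : 0 < σ - t := sub_pos.2 htσ
  have hqa' : 0 < a - q := sub_pos.2 hqa
  have hi := intervalIntegrable_kernel (q := q) hst.le htσ ha.le
  rw [kernelBound, mul_min_of_nonneg _ _ (by positivity)]
  refine le_min ?_ ?_
  · have hle : ∫ r in s..t, (σ - r) ^ (-q - 1) * (t - r) ^ a ≤
        ∫ r in s..t, q * (σ - r) ^ (-q - 1) * (1 / q * (t - s) ^ a) := by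
      refine intervalIntegral.integral_mono_on hst.le hi ?_ ?_
      · exact ((continuousOn_const.mul (continuousOn_rpow_sub htσ hst.le)).mul
          continuousOn_const).intervalIntegrable
      · intro r hr
        have hr0 : 0 < σ - r := by linarith [hr.2]
        have : (t - r) ^ a ≤ (t - s) ^ a :=
          Real.rpow_le_rpow (by linarith [hr.2]) (by linarith [hr.1]) ha.le
        calc (σ - r) ^ (-q - 1) * (t - r) ^ a ≤ (σ - r) ^ (-q - 1) * (t - s) ^ a := by gcongr
          _ = _ := by field_simp
    rw [intervalIntegral.integral_mul_const, integral_rpow_sub hst.le htσ] at hle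
    refine hle.trans ?_
    have h4 : 0 ≤ (σ - s) ^ (-q) := Real.rpow_nonneg (by linarith) _
    calc ((σ - t) ^ (-q) - (σ - s) ^ (-q)) * (1 / q * (t - s) ^ a)
        ≤ (σ - t) ^ (-q) * (1 / q * (t - s) ^ a) := by gcongr; linarith
      _ ≤ (σ - t) ^ (-q) * ((1 / q + 1 / (a - q)) * (T ^ (a - α) * (t - s) ^ α)) := by
          gcongr
          have : 0 < 1 / (a - q) := by positivity
          linarith
      _ = _ := by ring
  · have hint : ∫ r in s..t, (t - r) ^ (a - q - 1) = (t - s) ^ (a - q) / (a - q) := by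
      rw [intervalIntegral.integral_comp_sub_left (fun r => r ^ (a - q - 1)) t,
        integral_rpow (Or.inl (by linarith))]
      simp only [sub_self, sub_add_cancel]
      rw [Real.zero_rpow hqa'.ne', sub_zero]
    have hle : ∫ r in s..t, (σ - r) ^ (-q - 1) * (t - r) ^ a ≤
        ∫ r in s..t, (t - r) ^ (a - q - 1) := by
      refine intervalIntegral.integral_mono_on_of_le_Ioo hst.le hi ?_ ?_
      · have := (intervalIntegral.intervalIntegrable_rpow' (a := t - s) (b := t - t)
          (r := a - q - 1) (by linarith)).comp_sub_left t
        simpa using this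
      · intro r hr
        have hr0 : 0 < t - r := by linarith [hr.2]
        have : (σ - r) ^ (-q - 1) ≤ (t - r) ^ (-q - 1) :=
          Real.rpow_le_rpow_of_nonpos hr0 (by linarith) (by linarith)
        calc (σ - r) ^ (-q - 1) * (t - r) ^ a ≤ (t - r) ^ (-q - 1) * (t - r) ^ a := by gcongr
          _ = _ := by rw [← Real.rpow_add hr0]; ring_nf
    refine hle.trans ?_
    rw [hint]
    have h6 : (t - s) ^ (a - q) ≤ T ^ (a - α) * (t - s) ^ (α - q) := by
      have := rpow_le_mul_rpow_of_le hts hT (a := a - q) (α := α - q) (by linarith)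
      convert this using 3
      ring
    calc (t - s) ^ (a - q) / (a - q) = 1 / (a - q) * (t - s) ^ (a - q) := by ring
      _ ≤ (1 / q + 1 / (a - q)) * (T ^ (a - α) * (t - s) ^ (α - q)) := by
          gcongr
          have : 0 < 1 / q := by positivity
          linarith
      _ = _ := by ring

/-! ### Young integrals of power kernels against Hölder paths -/

/-- `x` is Hölder continuous of order `a` with constant `K`. -/
def HolderBound (K a : ℝ) (x : ℝ → ℝ) : Prop := ∀ u v, |x u - x v| ≤ K * |u - v| ^ a

lemma HolderBound.continuous {K a : ℝ} {x : ℝ → ℝ} (h : HolderBound K a x) (ha : 0 < a) :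
    Continuous x := by
  refine continuous_iff_continuousAt.2 fun v => ?_
  rw [ContinuousAt, tendsto_iff_norm_sub_tendsto_zero]
  refine squeeze_zero (fun _ => norm_nonneg _) (fun u => h u v) ?_
  have : Continuous fun u : ℝ => K * |u - v| ^ a :=
    continuous_const.mul ((continuous_id.sub continuous_const).abs.rpow_const
      fun _ => Or.inr ha.le)
  simpa [Real.zero_rpow ha.ne'] using this.tendsto v

/-- The integral `∫_s^t (τ-r)^{-γ} dx_r`, defined through integration by parts. -/
noncomputable def pathIntegral (γ : ℝ) (x : ℝ → ℝ) (s t τ : ℝ) : ℝ :=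
  (τ - t) ^ (-γ) * x t - (τ - s) ^ (-γ) * x s - ∫ r in s..t, γ * (τ - r) ^ (-γ - 1) * x r

/-- The kernel `γ(τ-r)^{-γ-1}` has integral `(τ-t)^{-γ} - (τ-s)^{-γ}`, so the boundary term at `t`
can be absorbed into the integral. Only increments of `x` ending at `t` remain, which is where
Hölder regularity enters. -/
lemma pathIntegral_eq {γ s t τ : ℝ} {x : ℝ → ℝ} (hx : Continuous x) (hst : s ≤ t) (htτ : t < τ) :
    pathIntegral γ x s t τ = (τ - s) ^ (-γ) * (x t - x s) +
      ∫ r in s..t, γ * (τ - r) ^ (-γ - 1) * (x t - x r) := by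
  have hc := continuousOn_const (c := γ).mul (continuousOn_rpow_sub (p := -γ - 1) htτ hst)
  have h1 : ∫ r in s..t, γ * (τ - r) ^ (-γ - 1) * (x t - x r) =
      (∫ r in s..t, γ * (τ - r) ^ (-γ - 1) * x t) -
        ∫ r in s..t, γ * (τ - r) ^ (-γ - 1) * x r := by
    rw [← intervalIntegral.integral_sub]
    · simp only [mul_sub]
    · exact (hc.mul continuousOn_const).intervalIntegrable
    · exact (hc.mul hx.continuousOn).intervalIntegrable
  rw [h1, intervalIntegral.integral_mul_const, integral_rpow_sub hst htτ, pathIntegral]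
  ring

/-- Serves both parts of the norm. For the 1-norm, `A` and `G` are the kernel at `s` and its
derivative; for the (1,2)-norm they are the differences of these between `τ'` and `τ`, with `q = γ +
ζ` and `D` carrying the factor in `τ - τ'`. -/
lemma abs_young_le {s t σ T q α a K D A : ℝ} {G x : ℝ → ℝ} (hst : s < t) (htσ : t < σ)
    (hT : t - s ≤ T) (hq : 0 < q) (hqa : q < a) (hαa : α ≤ a) (hx : HolderBound K a x)
    (hA : |A| ≤ D * (σ - s) ^ (-q))
    (hG : ∀ r ∈ Set.Icc s t, |G r| ≤ D * (σ - r) ^ (-q - 1)) :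
    |A * (x t - x s) + ∫ r in s..t, G r * (x t - x r)| ≤
      (1 + 1 / q + 1 / (a - q)) * T ^ (a - α) * (K * D * kernelBound α q σ t s) := by
  have hts : 0 < t - s := sub_pos.2 hst
  have hK : 0 ≤ K := by
    have := (abs_nonneg _).trans (hx t s)
    rw [abs_of_pos hts] at this
    exact nonneg_of_mul_nonneg_left this (by positivity)
  have hD : 0 ≤ D := nonneg_of_mul_nonneg_left ((abs_nonneg _).trans hA)
    (Real.rpow_pos_of_pos (by linarith) _)
  have hi := intervalIntegrable_kernel (q := q) hst.le htσ (hq.trans hqa).le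
  have h1 : |A * (x t - x s)| ≤ D * K * ((σ - s) ^ (-q) * (t - s) ^ a) := by
    rw [abs_mul]
    have := hx t s
    rw [abs_of_pos hts] at this
    calc |A| * |x t - x s| ≤ (D * (σ - s) ^ (-q)) * (K * (t - s) ^ a) :=
          mul_le_mul hA this (abs_nonneg _) ((abs_nonneg _).trans hA)
      _ = _ := by ring
  have h2 : |∫ r in s..t, G r * (x t - x r)| ≤
      ∫ r in s..t, D * K * ((σ - r) ^ (-q - 1) * (t - r) ^ a) := by
    rw [← Real.norm_eq_abs]
    refine intervalIntegral.norm_integral_le_of_norm_le hst.le ?_ (hi.const_mul _)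
    refine ae_of_all _ fun r hr => ?_
    have hr' : 0 ≤ t - r := by linarith [hr.2]
    rw [Real.norm_eq_abs, abs_mul]
    have := hx t r
    rw [abs_of_nonneg hr'] at this
    have hGr := hG r ⟨hr.1.le, hr.2⟩
    calc |G r| * |x t - x r| ≤ (D * (σ - r) ^ (-q - 1)) * (K * (t - r) ^ a) :=
          mul_le_mul hGr this (abs_nonneg _) ((abs_nonneg _).trans hGr)
      _ = _ := by ring
  rw [intervalIntegral.integral_const_mul] at h2
  have h3 := boundary_le_kernelBound hst htσ hT hq hαa
  have h4 := integral_le_kernelBound hst htσ hT hq hqa hαa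
  have hDK : 0 ≤ D * K := mul_nonneg hD hK
  calc _ ≤ |A * (x t - x s)| + |∫ r in s..t, G r * (x t - x r)| := abs_add_le _ _
    _ ≤ D * K * (T ^ (a - α) * kernelBound α q σ t s) +
        D * K * ((1 / q + 1 / (a - q)) * T ^ (a - α) * kernelBound α q σ t s) := by
          gcongr
          · exact h1.trans (by gcongr)
          · exact h2.trans (by gcongr)
    _ = _ := by ring

lemma psi1_eq {α γ τ t s : ℝ} (hst : s < t) (htτ : t < τ) :
    psi1 α γ τ t s = kernelBound α γ τ t s := by
  rw [psi1, kernelBound, abs_of_pos (sub_pos.2 hst), abs_of_pos (sub_pos.2 htτ)]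

lemma psi12_eq {α γ η ζ τ τ' t s : ℝ} (hst : s < t) (htτ' : t < τ') (hτ : τ' < τ) :
    psi12 α γ η ζ τ τ' t s =
      (τ - τ') ^ η * (τ' - t) ^ (-(η - ζ)) * kernelBound α (γ + ζ) τ' t s := by
  rw [psi12, kernelBound, abs_of_pos (sub_pos.2 hst), abs_of_pos (sub_pos.2 htτ'),
    abs_of_pos (sub_pos.2 hτ), neg_add', sub_sub]

lemma kernelBound_pos {α q σ t s : ℝ} (hst : s < t) (htσ : t < σ) : 0 < kernelBound α q σ t s := by
  have := sub_pos.2 hst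
  have := sub_pos.2 htσ
  exact lt_min (by positivity) (by positivity)

lemma abs_pathIntegral_le {s t τ T γ α a K : ℝ} {x : ℝ → ℝ} (hst : s < t) (htτ : t < τ)
    (hT : t - s ≤ T) (hγ : 0 < γ) (hγ1 : γ ≤ 1) (hγa : γ < a) (hαa : α ≤ a)
    (hx : HolderBound K a x) :
    |pathIntegral γ x s t τ| ≤
      (1 + 1 / γ + 1 / (a - γ)) * T ^ (a - α) * (K * psi1 α γ τ t s) := by
  rw [pathIntegral_eq (hx.continuous (hγ.trans hγa)) hst.le htτ, psi1_eq hst htτ]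
  have := abs_young_le (D := 1) (A := (τ - s) ^ (-γ)) (G := fun r => γ * (τ - r) ^ (-γ - 1))
    hst htτ hT hγ hγa hαa hx ?_ ?_
  · simpa using this
  · rw [one_mul, abs_of_nonneg (Real.rpow_nonneg (by linarith) _)]
  · intro r hr
    have hr0 : 0 < τ - r := by linarith [hr.2]
    rw [abs_of_nonneg (by positivity)]
    gcongr

lemma abs_pathIntegral_sub_le {s t τ τ' T γ α a K η ζ : ℝ} {x : ℝ → ℝ} (hst : s < t)
    (htτ' : t < τ') (hτ : τ' < τ) (hT : t - s ≤ T) (hγ : 0 < γ) (hγ1 : γ ≤ 1)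
    (hη0 : 0 ≤ η) (hη1 : η ≤ 1) (hζ0 : 0 ≤ ζ) (hζη : ζ ≤ η) (hγa : γ + ζ < a) (hαa : α ≤ a)
    (hx : HolderBound K a x) :
    |pathIntegral γ x s t τ - pathIntegral γ x s t τ'| ≤
      2 * (1 + 1 / (γ + ζ) + 1 / (a - (γ + ζ))) * T ^ (a - α) *
        (K * psi12 α γ η ζ τ τ' t s) := by
  have ha : 0 < a := by linarith
  have hc := hx.continuous ha
  have hd : 0 < τ - τ' := sub_pos.2 hτ
  have hσ : 0 < τ' - t := sub_pos.2 htτ'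
  rw [abs_sub_comm, pathIntegral_eq hc hst.le htτ', pathIntegral_eq hc hst.le (htτ'.trans hτ),
    psi12_eq hst htτ' hτ]
  have hint : ∀ {σ : ℝ}, t < σ → IntervalIntegrable
      (fun r => γ * (σ - r) ^ (-γ - 1) * (x t - x r)) volume s t := fun {σ} hσ =>
    ((continuousOn_const.mul (continuousOn_rpow_sub hσ hst.le)).mul
      (continuous_const.sub hc).continuousOn).intervalIntegrable
  have heq : (τ' - s) ^ (-γ) * (x t - x s) + (∫ r in s..t, γ * (τ' - r) ^ (-γ - 1) * (x t - x r)) -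
      ((τ - s) ^ (-γ) * (x t - x s) + ∫ r in s..t, γ * (τ - r) ^ (-γ - 1) * (x t - x r)) =
      ((τ' - s) ^ (-γ) - (τ - s) ^ (-γ)) * (x t - x s) +
      ∫ r in s..t, (γ * (τ' - r) ^ (-γ - 1) - γ * (τ - r) ^ (-γ - 1)) * (x t - x r) := by
    have : ∫ r in s..t, (γ * (τ' - r) ^ (-γ - 1) - γ * (τ - r) ^ (-γ - 1)) * (x t - x r) =
      (∫ r in s..t, γ * (τ' - r) ^ (-γ - 1) * (x t - x r)) -
        ∫ r in s..t, γ * (τ - r) ^ (-γ - 1) * (x t - x r) := by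
      rw [← intervalIntegral.integral_sub (hint htτ') (hint (htτ'.trans hτ))]
      simp only [sub_mul]
    rw [this]
    ring
  -- Of the power `-η` produced by interpolation, `-(η-ζ)` is evaluated at the worst point `r = t`
  -- and `-ζ` stays in the kernel. The cases used are `p = γ` for the boundary term and `p = γ + 1 ≤
  -- 2` for the density, whence the constant 2.
  have key : ∀ p r : ℝ, 0 < p → p ≤ 2 → r ≤ t →
      |(τ' - r) ^ (-p) - (τ - r) ^ (-p)| ≤
        2 * ((τ - τ') ^ η * (τ' - t) ^ (-(η - ζ))) * (τ' - r) ^ (-p - ζ) := by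
    intro p r hp hp2 hr
    have hr0 : 0 < τ' - r := by linarith
    have h1 := rpow_neg_sub_rpow_neg_le hr0 hd hp hη0 hη1
    rw [show τ' - r + (τ - τ') = τ - r by ring] at h1
    rw [abs_of_nonneg (sub_nonneg.2
      (Real.rpow_le_rpow_of_nonpos hr0 (by linarith) (by linarith)))]
    refine h1.trans ?_
    have h2 : (τ' - r) ^ (-p - η) = (τ' - r) ^ (-(η - ζ)) * (τ' - r) ^ (-p - ζ) := by
      rw [← Real.rpow_add hr0]; ring_nf
    have h3 : (τ' - r) ^ (-(η - ζ)) ≤ (τ' - t) ^ (-(η - ζ)) :=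
      Real.rpow_le_rpow_of_nonpos hσ (by linarith) (by linarith)
    rw [h2]
    calc max 1 p * ((τ - τ') ^ η * ((τ' - r) ^ (-(η - ζ)) * (τ' - r) ^ (-p - ζ)))
        ≤ 2 * ((τ - τ') ^ η * ((τ' - t) ^ (-(η - ζ)) * (τ' - r) ^ (-p - ζ))) := by
          gcongr
          exact max_le (by norm_num) hp2
      _ = _ := by ring
  rw [heq]
  have := abs_young_le (D := 2 * ((τ - τ') ^ η * (τ' - t) ^ (-(η - ζ)))) (q := γ + ζ)
    (A := (τ' - s) ^ (-γ) - (τ - s) ^ (-γ))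
    (G := fun r => γ * (τ' - r) ^ (-γ - 1) - γ * (τ - r) ^ (-γ - 1))
    hst htτ' hT (by linarith) hγa hαa hx ?_ ?_
  · refine this.trans (le_of_eq ?_)
    ring
  · rw [neg_add']
    exact key γ s hγ (by linarith) hst.le
  · intro r hr
    have h1 := key (γ + 1) r (by linarith) (by linarith) hr.2
    rw [← mul_sub, abs_mul, abs_of_pos hγ]
    rw [neg_add'] at h1
    rw [show -(γ + ζ) - 1 = -γ - 1 - ζ by ring]
    calc _ ≤ 1 * |(τ' - r) ^ (-γ - 1) - (τ - r) ^ (-γ - 1)| := by gcongr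
      _ ≤ _ := by rwa [one_mul]

lemma continuousOn_pathIntegral {γ T : ℝ} {x : ℝ → ℝ} (hx : Continuous x) :
    ContinuousOn (fun y : ℝ × ℝ × ℝ => pathIntegral γ x y.1 y.2.1 y.2.2) (simplex3 T) := by
  rw [continuousOn_iff_continuous_domRestrict]
  have hs : Continuous fun y : simplex3 T => y.1.1 := by fun_prop
  have ht : Continuous fun y : simplex3 T => y.1.2.1 := by fun_prop
  have hτ : Continuous fun y : simplex3 T => y.1.2.2 := by fun_prop
  have hpos : ∀ y : simplex3 T, 0 < y.1.2.2 - y.1.2.1 := fun y => sub_pos.2 y.2.2.2.1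
  -- The maximum keeps the base positive for every real `r`, so `F` is jointly continuous; on
  -- `[s,t]` it equals `τ - r` and nothing changes. Integrals from the fixed endpoint 0 then depend
  -- continuously on the parameters.
  set F : simplex3 T → ℝ → ℝ := fun y r =>
    γ * (max (y.1.2.2 - r) (y.1.2.2 - y.1.2.1)) ^ (-γ - 1) * x r with hF
  have hFc : Continuous (Function.uncurry F) := by
    refine (continuous_const.mul (Continuous.rpow_const ?_ ?_)).mul (hx.comp continuous_snd)
    · exact ((hτ.comp continuous_fst).sub continuous_snd).max
        ((hτ.comp continuous_fst).sub (ht.comp continuous_fst))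
    · exact fun p => Or.inl (lt_max_of_lt_right (hpos p.1)).ne'
  have hI : Continuous fun y : simplex3 T =>
      (∫ r in (0 : ℝ)..y.1.2.1, F y r) - ∫ r in (0 : ℝ)..y.1.1, F y r :=
    (intervalIntegral.continuous_parametric_intervalIntegral_of_continuous hFc ht).sub
      (intervalIntegral.continuous_parametric_intervalIntegral_of_continuous hFc hs)
  have hii : ∀ (y : simplex3 T) (u v : ℝ), IntervalIntegrable (F y) volume u v := fun y u v =>
    (hFc.comp (Continuous.prodMk_right y)).intervalIntegrable _ _
  have heq : ∀ y : simplex3 T,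
      ∫ r in y.1.1..y.1.2.1, γ * (y.1.2.2 - r) ^ (-γ - 1) * x r =
      (∫ r in (0 : ℝ)..y.1.2.1, F y r) - ∫ r in (0 : ℝ)..y.1.1, F y r := by
    intro y
    rw [intervalIntegral.integral_interval_sub_left (hii y _ _) (hii y _ _)]
    refine intervalIntegral.integral_congr fun r hr => ?_
    rw [Set.uIcc_of_le y.2.2.1.le] at hr
    simp only [hF]
    rw [max_eq_left (by linarith [hr.2])]
  have h1 : Continuous fun y : simplex3 T => (y.1.2.2 - y.1.2.1) ^ (-γ) :=
    (hτ.sub ht).rpow_const fun y => Or.inl (hpos y).ne'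
  have h2 : Continuous fun y : simplex3 T => (y.1.2.2 - y.1.1) ^ (-γ) :=
    (hτ.sub hs).rpow_const fun y =>
      Or.inl (sub_pos.2 (y.2.2.1.trans y.2.2.2.1)).ne'
  have : Set.domRestrict (simplex3 T) (fun y : ℝ × ℝ × ℝ => pathIntegral γ x y.1 y.2.1 y.2.2) =
      fun y : simplex3 T => (y.1.2.2 - y.1.2.1) ^ (-γ) * x y.1.2.1 -
        (y.1.2.2 - y.1.1) ^ (-γ) * x y.1.1 -
        ((∫ r in (0 : ℝ)..y.1.2.1, F y r) - ∫ r in (0 : ℝ)..y.1.1, F y r) := by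
    funext y
    rw [← heq y]
    rfl
  rw [this]
  exact ((h1.mul (hx.comp ht)).sub (h2.mul (hx.comp hs))).sub hI

/-! ### Convergence of Riemann sums to the pathwise integral. -/

/-- The `k`-th point of the partition of `[s,t]` into `n` equal pieces. -/
noncomputable def partitionPoint (s t : ℝ) (n k : ℕ) : ℝ := s + k * ((t - s) / n)

lemma partitionPoint_zero (s t : ℝ) (n : ℕ) : partitionPoint s t n 0 = s := by
  simp [partitionPoint]

lemma partitionPoint_self (s t : ℝ) {n : ℕ} (hn : n ≠ 0) : partitionPoint s t n n = t := by
  have : (n : ℝ) ≠ 0 := Nat.cast_ne_zero.2 hn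
  rw [partitionPoint]
  field_simp
  ring

lemma partitionPoint_succ_sub (s t : ℝ) (n k : ℕ) :
    partitionPoint s t n (k + 1) - partitionPoint s t n k = (t - s) / n := by
  simp only [partitionPoint]
  push_cast
  ring

lemma partitionPoint_mono {s t : ℝ} (hst : s ≤ t) (n : ℕ) : Monotone (partitionPoint s t n) := by
  intro k l hkl
  simp only [partitionPoint]
  have : 0 ≤ (t - s) / n := div_nonneg (sub_nonneg.2 hst) n.cast_nonneg
  gcongr

lemma partitionPoint_mem {s t : ℝ} (hst : s ≤ t) {n k : ℕ} (hk : k ≤ n) (hn : n ≠ 0) :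
    partitionPoint s t n k ∈ Set.Icc s t := by
  constructor
  · simpa [partitionPoint_zero] using partitionPoint_mono hst n k.zero_le
  · simpa [partitionPoint_self s t hn] using partitionPoint_mono hst n hk

/-- Left-point Riemann sums of `∫_s^t (τ-r)^{-γ} dx_r`. -/
noncomputable def riemannSum (γ : ℝ) (x : ℝ → ℝ) (s t τ : ℝ) (n : ℕ) : ℝ :=
  ∑ k ∈ Finset.range n, (τ - partitionPoint s t n k) ^ (-γ) *
    (x (partitionPoint s t n (k + 1)) - x (partitionPoint s t n k))

lemma pathIntegral_add {γ u v w τ : ℝ} {x : ℝ → ℝ} (hx : Continuous x) (huv : u ≤ v) (hvw : v ≤ w)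
    (hw : w < τ) :
    pathIntegral γ x u v τ + pathIntegral γ x v w τ = pathIntegral γ x u w τ := by
  have hi : ∀ {u v : ℝ}, u ≤ v → v < τ → IntervalIntegrable
      (fun r => γ * (τ - r) ^ (-γ - 1) * x r) volume u v := fun h h' =>
    ((continuousOn_const.mul (continuousOn_rpow_sub h' h)).mul hx.continuousOn).intervalIntegrable
  have := intervalIntegral.integral_add_adjacent_intervals (hi huv (hvw.trans_lt hw)) (hi hvw hw)
  simp only [pathIntegral]
  rw [← this]
  ring

lemma sum_pathIntegral {γ s t τ : ℝ} {x : ℝ → ℝ} (hx : Continuous x) (hst : s ≤ t) (ht : t < τ)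
    {n : ℕ} (hn : n ≠ 0) :
    ∑ k ∈ Finset.range n,
      pathIntegral γ x (partitionPoint s t n k) (partitionPoint s t n (k + 1)) τ =
      pathIntegral γ x s t τ := by
  have : ∀ j ≤ n, ∑ k ∈ Finset.range j,
      pathIntegral γ x (partitionPoint s t n k) (partitionPoint s t n (k + 1)) τ =
      pathIntegral γ x s (partitionPoint s t n j) τ := by
    intro j
    induction j with
    | zero => intro _; simp [partitionPoint_zero, pathIntegral]
    | succ j ih =>
      intro hj
      rw [Finset.sum_range_succ, ih (by omega), pathIntegral_add hx]
      · exact (partitionPoint_mem hst (by omega) hn).1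
      · exact partitionPoint_mono hst n j.le_succ
      · exact (partitionPoint_mem hst hj hn).2.trans_lt ht
  simpa [partitionPoint_self s t hn] using this n le_rfl

/-- On each cell the Riemann term is exactly the boundary term of `pathIntegral_eq`, so the error is
the remaining integral. It is at most `K δ^a`, with `δ` the mesh, times the increment of
`(τ-·)^{-γ}` over the cell, and these increments telescope. -/
lemma abs_riemannSum_sub_pathIntegral_le {γ s t τ a K : ℝ} {x : ℝ → ℝ} (hγ : 0 < γ) (ha : 0 < a)
    (hst : s ≤ t) (ht : t < τ) (hx : HolderBound K a x) {n : ℕ} (hn : n ≠ 0) (hK : 0 ≤ K) :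
    |riemannSum γ x s t τ n - pathIntegral γ x s t τ| ≤
      K * ((t - s) / n) ^ a * (τ - t) ^ (-γ) := by
  have hc := hx.continuous ha
  have hδ : 0 ≤ (t - s) / n := div_nonneg (sub_nonneg.2 hst) n.cast_nonneg
  rw [← sum_pathIntegral hc hst ht hn, riemannSum, ← Finset.sum_sub_distrib]
  have hterm : ∀ k ∈ Finset.range n,
      |(τ - partitionPoint s t n k) ^ (-γ) *
        (x (partitionPoint s t n (k + 1)) - x (partitionPoint s t n k)) -
        pathIntegral γ x (partitionPoint s t n k) (partitionPoint s t n (k + 1)) τ| ≤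
      K * ((t - s) / n) ^ a * ((τ - partitionPoint s t n (k + 1)) ^ (-γ) -
        (τ - partitionPoint s t n k) ^ (-γ)) := by
    intro k hk
    have hk := Finset.mem_range.1 hk
    have hle : partitionPoint s t n k ≤ partitionPoint s t n (k + 1) :=
      partitionPoint_mono hst n k.le_succ
    have hlt : partitionPoint s t n (k + 1) < τ :=
      (partitionPoint_mem hst (by omega : k + 1 ≤ n) hn).2.trans_lt ht
    have hsub := partitionPoint_succ_sub s t n k
    rw [pathIntegral_eq hc hle hlt, sub_add_cancel_left, abs_neg, ← integral_rpow_sub hle hlt,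
      ← intervalIntegral.integral_const_mul, ← Real.norm_eq_abs]
    refine intervalIntegral.norm_integral_le_of_norm_le hle ?_ ?_
    · refine ae_of_all _ fun r hr => ?_
      have hr0 : 0 < τ - r := by linarith [hr.2]
      rw [Real.norm_eq_abs, abs_mul, abs_of_nonneg (by positivity), mul_comm]
      gcongr
      refine (hx _ _).trans ?_
      gcongr
      rw [abs_of_nonneg (by linarith [hr.2])]
      linarith [hr.1]
    · exact (continuousOn_const.mul (continuousOn_const.mul
        (continuousOn_rpow_sub hlt hle))).intervalIntegrable
  refine (Finset.abs_sum_le_sum_abs _ _).trans ((Finset.sum_le_sum hterm).trans ?_)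
  rw [← Finset.mul_sum, Finset.sum_range_sub fun k => (τ - partitionPoint s t n k) ^ (-γ),
    partitionPoint_self s t hn, partitionPoint_zero]
  have : 0 ≤ (τ - s) ^ (-γ) := Real.rpow_nonneg (by linarith) _
  gcongr
  linarith

/-! ### Hölder continuous versions by dyadic chaining -/

/-- The dyadic point `T k 2^{-n}`, projected to `[0,T]`. -/
noncomputable def dyadicPoint {T : ℝ} (hT : 0 ≤ T) (n k : ℕ) : Set.Icc (0 : ℝ) T :=
  Set.projIcc 0 T hT (T * (k / 2 ^ n))

/-- The position of `t` in `[0,T]`, normalized to `[0,1]`. -/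
noncomputable def normalize (T t : ℝ) : ℝ := max 0 (min T t) / T

/-- The index of the dyadic point of level `n` below `t`. -/
noncomputable def dyadicIndex (T : ℝ) (n : ℕ) (t : ℝ) : ℕ := ⌊2 ^ n * normalize T t⌋₊

/-- The approximation of the path `y` that is constant on dyadic intervals of level `n`. -/
noncomputable def dyadicApprox {T : ℝ} (hT : 0 ≤ T) (y : Set.Icc (0 : ℝ) T → ℝ) (n : ℕ) (t : ℝ) :
    ℝ :=
  y (dyadicPoint hT n (dyadicIndex T n t))

lemma normalize_nonneg {T : ℝ} (hT : 0 < T) (t : ℝ) : 0 ≤ normalize T t := by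
  unfold normalize; positivity

lemma normalize_le_one {T : ℝ} (hT : 0 < T) (t : ℝ) : normalize T t ≤ 1 := by
  unfold normalize
  rw [div_le_one hT]
  exact max_le hT.le (min_le_left _ _)

lemma normalize_of_mem {T t : ℝ} (ht : t ∈ Set.Icc 0 T) : normalize T t = t / T := by
  rw [normalize, min_eq_right ht.2, max_eq_right ht.1]

lemma abs_normalize_sub_le {T : ℝ} (hT : 0 < T) (u v : ℝ) :
    |normalize T u - normalize T v| ≤ |u - v| / T := by
  unfold normalize
  rw [← sub_div, abs_div, abs_of_pos hT]
  refine div_le_div_of_nonneg_right ?_ hT.le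
  have h1 := abs_max_sub_max_le_max 0 (min T u) 0 (min T v)
  have h2 := abs_min_sub_min_le_max T u T v
  rw [sub_self, abs_zero] at h1 h2
  exact h1.trans (max_le (abs_nonneg _) (h2.trans (max_le (abs_nonneg _) le_rfl)))

lemma dyadicPoint_two_mul {T : ℝ} (hT : 0 ≤ T) (n k : ℕ) :
    dyadicPoint hT (n + 1) (2 * k) = dyadicPoint hT n k := by
  unfold dyadicPoint
  congr 2
  push_cast
  rw [pow_succ]
  field_simp

lemma dyadicIndex_le {T : ℝ} (hT : 0 < T) (n : ℕ) (t : ℝ) : dyadicIndex T n t ≤ 2 ^ n := by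
  have := normalize_le_one hT t
  unfold dyadicIndex
  refine Nat.floor_le_of_le ?_
  push_cast
  have : (0 : ℝ) < 2 ^ n := by positivity
  nlinarith

lemma dyadicIndex_succ {T : ℝ} (hT : 0 < T) (n : ℕ) (t : ℝ) :
    dyadicIndex T (n + 1) t = 2 * dyadicIndex T n t ∨
      dyadicIndex T (n + 1) t = 2 * dyadicIndex T n t + 1 := by
  have h0 : 0 ≤ 2 ^ n * normalize T t := mul_nonneg (by positivity) (normalize_nonneg hT t)
  have h1 := Nat.floor_le h0
  have h2 := Nat.lt_floor_add_one (2 ^ n * normalize T t)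
  have e : (2 : ℝ) ^ (n + 1) * normalize T t = 2 * (2 ^ n * normalize T t) := by ring
  have h3 : 2 * dyadicIndex T n t ≤ dyadicIndex T (n + 1) t := by
    unfold dyadicIndex
    rw [e]
    refine Nat.le_floor ?_
    push_cast
    linarith
  have h4 : dyadicIndex T (n + 1) t < 2 * dyadicIndex T n t + 2 := by
    unfold dyadicIndex
    rw [e, Nat.floor_lt (by linarith)]
    push_cast
    linarith
  omega

/-- The dyadic increments of `y` of level `n` are at most `S r ^ n`. -/
def DyadicBound {T : ℝ} (hT : 0 ≤ T) (y : Set.Icc (0 : ℝ) T → ℝ) (S r : ℝ) : Prop :=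
  ∀ n k : ℕ, k < 2 ^ n → |y (dyadicPoint hT n (k + 1)) - y (dyadicPoint hT n k)| ≤ S * r ^ n

section

variable {T : ℝ} (hT : 0 < T) {y : Set.Icc (0 : ℝ) T → ℝ} {S r : ℝ}

/-- The level `n` point below `t` is also a point of level `n+1`, and the level `n+1` point below
`t` is either that one or its right neighbour. -/
lemma dist_dyadicApprox_succ_le (h : DyadicBound hT.le y S r) (hS : 0 ≤ S) (hr : 0 < r)
    (hr1 : r < 1) (t : ℝ) (n : ℕ) :
    dist (dyadicApprox hT.le y n t) (dyadicApprox hT.le y (n + 1) t) ≤ S * r ^ n := by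
  rw [dist_comm, Real.dist_eq]
  unfold dyadicApprox
  rw [← dyadicPoint_two_mul hT.le n]
  rcases dyadicIndex_succ hT n t with e | e
  · rw [e, sub_self, abs_zero]
    positivity
  · have h1 := dyadicIndex_le hT (n + 1) t
    rw [e] at h1 ⊢
    refine (h (n + 1) _ (by omega)).trans ?_
    rw [pow_succ]
    have : 0 ≤ S * r ^ n := by positivity
    nlinarith

lemma tendsto_dyadicApprox (h : DyadicBound hT.le y S r) (hS : 0 ≤ S) (hr : 0 < r)
    (hr1 : r < 1) (t : ℝ) :
    Tendsto (fun n => dyadicApprox hT.le y n t) atTop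
      (𝓝 (limUnder atTop fun n => dyadicApprox hT.le y n t)) :=
  (cauchySeq_of_le_geometric r S hr1
    (dist_dyadicApprox_succ_le hT h hS hr hr1 t)).tendsto_limUnder

/-- Positions at most `2^{-n}` apart have level `n` indices that differ by at most one. -/
lemma abs_dyadicApprox_sub_le (h : DyadicBound hT.le y S r) (hS : 0 ≤ S) (hr : 0 < r)
    {u v : ℝ} {n : ℕ} (huv : |normalize T u - normalize T v| ≤ (1 / 2) ^ n) :
    |dyadicApprox hT.le y n u - dyadicApprox hT.le y n v| ≤ S * r ^ n := by
  wlog hle : normalize T v ≤ normalize T u generalizing u v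
  · rw [abs_sub_comm]
    exact this (by rwa [abs_sub_comm]) (le_of_not_ge hle)
  have hp : (0 : ℝ) < 2 ^ n := by positivity
  have h1 : dyadicIndex T n v ≤ dyadicIndex T n u := Nat.floor_le_floor (by gcongr)
  have h2 : dyadicIndex T n u ≤ dyadicIndex T n v + 1 := by
    unfold dyadicIndex
    rw [← Nat.floor_add_one (mul_nonneg hp.le (normalize_nonneg hT v))]
    refine Nat.floor_le_floor ?_
    have h3 := (le_abs_self _).trans huv
    have h4 : (2 : ℝ) ^ n * (1 / 2) ^ n = 1 := by rw [← mul_pow]; norm_num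
    nlinarith
  unfold dyadicApprox
  rcases (by omega : dyadicIndex T n u = dyadicIndex T n v ∨
    dyadicIndex T n u = dyadicIndex T n v + 1) with e | e
  · rw [e, sub_self, abs_zero]
    positivity
  · have := dyadicIndex_le hT n u
    rw [e]
    exact h n _ (by omega)

/-- With `r = 2^{-a}`, take the level `n` for which the normalized distance lies in `(2^{-n-1},
2^{-n}]`. Each limit is within the geometric tail `S r^n/(1-r)` of its level `n` approximation, and
the two approximations differ by at most `S r^n`. Finally `r^n = (2^{-n})^a ≤ (2|u-v|/T)^a`, which
accounts for the constant. -/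
lemma holderBound_limUnder_dyadicApprox {a : ℝ} (ha : 0 < a)
    (h : DyadicBound hT.le y S ((1 / 2) ^ a)) (hS : 0 ≤ S) :
    HolderBound ((1 + 2 / (1 - (1 / 2) ^ a)) * 2 ^ a * T ^ (-a) * S) a
      (fun t => limUnder atTop fun n => dyadicApprox hT.le y n t) := by
  intro u v
  set r : ℝ := (1 / 2) ^ a with hrdef
  have hr : 0 < r := by positivity
  have hr1 : r < 1 := Real.rpow_lt_one (by norm_num) (by norm_num) ha
  have hr1' : 0 < 1 - r := sub_pos.2 hr1
  -- Besides `u = v`, this covers distinct points that are clamped to the same endpoint of `[0,T]`.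
  by_cases hz : normalize T u = normalize T v
  · have : ∀ n, dyadicApprox hT.le y n u = dyadicApprox hT.le y n v := fun n => by
      unfold dyadicApprox dyadicIndex
      rw [hz]
    simp only [this, sub_self, abs_zero]
    positivity
  have hpos : 0 < |normalize T u - normalize T v| := abs_pos.2 (sub_ne_zero.2 hz)
  have hle1 : |normalize T u - normalize T v| ≤ 1 := by
    have h1 := normalize_nonneg hT u
    have h2 := normalize_nonneg hT v
    have h3 := normalize_le_one hT u
    have h4 := normalize_le_one hT v
    rw [abs_le]
    constructor <;> linarith
  obtain ⟨n, hn1, hn2⟩ := exists_nat_pow_near_of_lt_one hpos hle1 (y := (1 / 2 : ℝ))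
    (by norm_num) (by norm_num)
  have h1 := abs_dyadicApprox_sub_le hT h hS hr hn2
  have hd := fun t => dist_le_of_le_geometric_of_tendsto r S hr1
    (dist_dyadicApprox_succ_le hT h hS hr hr1 t) (tendsto_dyadicApprox hT h hS hr hr1 t) n
  have hu := hd u
  have hv := hd v
  rw [Real.dist_eq] at hu hv
  have hrn : r ^ n ≤ 2 ^ a * T ^ (-a) * |u - v| ^ a := by
    have e1 : r ^ n = ((1 / 2) ^ n) ^ a := by
      rw [hrdef, ← Real.rpow_natCast, ← Real.rpow_mul (by norm_num), mul_comm,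
        Real.rpow_mul (by norm_num), Real.rpow_natCast]
    have e2 : (1 / 2 : ℝ) ^ n ≤ 2 * (T⁻¹ * |u - v|) := by
      have := abs_normalize_sub_le hT u v
      rw [pow_succ] at hn1
      rw [div_eq_inv_mul] at this
      linarith
    rw [e1]
    refine (Real.rpow_le_rpow (by positivity) e2 ha.le).trans (le_of_eq ?_)
    rw [Real.mul_rpow (by norm_num) (by positivity), Real.mul_rpow (by positivity) (by positivity),
      Real.inv_rpow hT.le, Real.rpow_neg hT.le]
    ring
  set lu := limUnder atTop fun n => dyadicApprox hT.le y n u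
  set lv := limUnder atTop fun n => dyadicApprox hT.le y n v
  have htri : |lu - lv| ≤ S * r ^ n / (1 - r) + S * r ^ n + S * r ^ n / (1 - r) := by
    have e : lu - lv = -(dyadicApprox hT.le y n u - lu) +
      (dyadicApprox hT.le y n u - dyadicApprox hT.le y n v) +
      (dyadicApprox hT.le y n v - lv) := by ring
    rw [e]
    refine (abs_add_three _ _ _).trans ?_
    rw [abs_neg]
    gcongr
  calc |lu - lv| ≤ S * r ^ n / (1 - r) + S * r ^ n + S * r ^ n / (1 - r) := htri
    _ = (1 + 2 / (1 - r)) * S * r ^ n := by ring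
    _ ≤ (1 + 2 / (1 - r)) * S * (2 ^ a * T ^ (-a) * |u - v| ^ a) := by gcongr
    _ = _ := by ring

lemma abs_dyadicPoint_sub_le (n : ℕ) (t : Set.Icc (0 : ℝ) T) :
    |(dyadicPoint hT.le n (dyadicIndex T n t) : ℝ) - t| ≤ T * (1 / 2) ^ n := by
  have hp : (0 : ℝ) < 2 ^ n := by positivity
  have h0 := normalize_nonneg hT t
  have h1 := Nat.floor_le (mul_nonneg hp.le h0)
  have h2 := Nat.lt_floor_add_one (2 ^ n * normalize T t)
  have hle := dyadicIndex_le hT n t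
  have hle' : (dyadicIndex T n t : ℝ) ≤ 2 ^ n := by exact_mod_cast hle
  have hmem : T * (dyadicIndex T n t / 2 ^ n) ∈ Set.Icc 0 T :=
    ⟨by positivity, mul_le_of_le_one_right hT.le ((div_le_one hp).2 hle')⟩
  rw [dyadicPoint, Set.projIcc_of_mem hT.le hmem]
  change |T * (dyadicIndex T n t / 2 ^ n) - (t : ℝ)| ≤ _
  have e : (t : ℝ) = T * normalize T t := by
    rw [normalize_of_mem t.2]
    field_simp
  have e' : ((1 : ℝ) / 2) ^ n = 1 / 2 ^ n := by rw [div_pow, one_pow]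
  have e2 : T * (dyadicIndex T n t / 2 ^ n) - (t : ℝ) =
      T * (dyadicIndex T n t / 2 ^ n - normalize T t) := by rw [mul_sub, ← e]
  change (dyadicIndex T n t : ℝ) ≤ _ at h1
  change _ < (dyadicIndex T n t : ℝ) + 1 at h2
  rw [e2, abs_mul, abs_of_pos hT, e']
  gcongr
  rw [abs_le]
  constructor
  · rw [neg_le_sub_iff_le_add, ← add_div, le_div_iff₀ hp]
    linarith
  · have : (dyadicIndex T n t : ℝ) / 2 ^ n ≤ normalize T t := by
      rw [div_le_iff₀ hp]; linarith
    have : (0 : ℝ) ≤ 1 / 2 ^ n := by positivity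
    linarith

end

/-! ### Moments of the random Hölder constant. -/

section

variable {Ω : Type*} {T : ℝ} (hT : 0 < T)
  {b : Set.Icc (0 : ℝ) T → Ω → ℝ}

/-- The weighted dyadic increment `2^{na} |b_{T(k+1)2^{-n}} - b_{Tk2^{-n}}|`. -/
noncomputable def dyadicIncrement (b : Set.Icc (0 : ℝ) T → Ω → ℝ) (a : ℝ) (n k : ℕ) (ω : Ω) :
    ℝ≥0∞ :=
  ENNReal.ofReal ((2 ^ n) ^ a) *
    ‖b (dyadicPoint hT.le n (k + 1)) ω - b (dyadicPoint hT.le n k) ω‖ₑ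

/-- The supremum of the weighted dyadic increments. -/
noncomputable def dyadicSup (b : Set.Icc (0 : ℝ) T → Ω → ℝ) (a : ℝ) (ω : Ω) : ℝ≥0∞ :=
  ⨆ n : ℕ, ⨆ k ∈ Finset.range (2 ^ n), dyadicIncrement hT b a n k ω

lemma dyadicSup_rpow_le (a : ℝ) {q : ℝ} (hq : 0 < q) (ω : Ω) :
    dyadicSup hT b a ω ^ q ≤
      ∑' n : ℕ, ∑ k ∈ Finset.range (2 ^ n), dyadicIncrement hT b a n k ω ^ q := by
  rw [← ENNReal.le_rpow_inv_iff hq]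
  refine iSup_le fun n => iSup₂_le fun k hk => ?_
  rw [ENNReal.le_rpow_inv_iff hq]
  exact (Finset.single_le_sum (f := fun k => dyadicIncrement hT b a n k ω ^ q)
    (fun _ _ => zero_le) hk).trans
    (ENNReal.le_tsum (f := fun n => ∑ k ∈ Finset.range (2 ^ n), dyadicIncrement hT b a n k ω ^ q) n)

lemma dyadicBound_of_dyadicSup_lt_top {a : ℝ} {ω : Ω} (h : dyadicSup hT b a ω < ∞) :
    DyadicBound hT.le (fun t => b t ω) (dyadicSup hT b a ω).toReal ((1 / 2) ^ a) := by
  intro n k hk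
  have h1 : dyadicIncrement hT b a n k ω ≤ dyadicSup hT b a ω :=
    le_iSup_of_le n (le_iSup₂_of_le k (Finset.mem_range.2 hk) le_rfl)
  have h2 := ENNReal.toReal_mono h.ne h1
  rw [dyadicIncrement, ENNReal.toReal_mul, ENNReal.toReal_ofReal (by positivity),
    toReal_enorm, Real.norm_eq_abs] at h2
  have e : (((1 : ℝ) / 2) ^ a) ^ n = ((2 ^ n) ^ a)⁻¹ := by
    rw [← Real.rpow_natCast, ← Real.rpow_mul (by norm_num), mul_comm, Real.rpow_mul (by norm_num),
      Real.rpow_natCast, ← Real.inv_rpow (by positivity)]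
    congr 1
    rw [div_pow, one_pow, one_div]
  rw [e, ← div_eq_mul_inv, le_div_iff₀ (by positivity), mul_comm]
  exact h2

variable [MeasurableSpace Ω] {P : Measure Ω}

/-- The moment condition of the Kolmogorov continuity criterion, of all orders. -/
def MomentBound (P : Measure Ω) (H : ℝ) (b : Set.Icc (0 : ℝ) T → Ω → ℝ) : Prop :=
  ∀ q : ℝ, 1 ≤ q → ∃ C : ℝ≥0∞, C ≠ ∞ ∧ ∀ s t : Set.Icc (0 : ℝ) T,
    ∫⁻ ω, ‖b s ω - b t ω‖ₑ ^ q ∂P ≤ C * ENNReal.ofReal (|(s : ℝ) - t| ^ (H * q))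

lemma aemeasurable_dyadicIncrement (hb : ∀ t, AEMeasurable (b t) P) (a : ℝ) (n k : ℕ) :
    AEMeasurable (dyadicIncrement hT b a n k) P :=
  (((hb _).sub (hb _)).enorm).const_mul _

lemma aemeasurable_dyadicSup (hb : ∀ t, AEMeasurable (b t) P) (a : ℝ) :
    AEMeasurable (dyadicSup hT b a) P :=
  AEMeasurable.iSup fun n => AEMeasurable.biSup _ (Finset.range (2 ^ n)).countable_toSet
    fun k _ => aemeasurable_dyadicIncrement hT hb a n k

lemma abs_dyadicPoint_succ_sub_le (n k : ℕ) :
    |(dyadicPoint hT.le n (k + 1) : ℝ) - dyadicPoint hT.le n k| ≤ T * (2 ^ n)⁻¹ := by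
  have h := Set.abs_projIcc_sub_projIcc (h := hT.le) (c := T * ((k + 1 : ℕ) / 2 ^ n))
    (d := T * (k / 2 ^ n))
  refine h.trans (le_of_eq ?_)
  rw [← mul_sub, ← sub_div, abs_of_nonneg (by push_cast; simp; positivity)]
  push_cast
  ring

/-- Bound the supremum by a sum. Level `n` has `2^n` increments, each with weighted `q`-th moment of
order `2^{naq} 2^{-nHq}`, so its total is of order `x^n` with `x = 2^{1-(H-a)q} < 1`. -/
lemma lintegral_dyadicSup_rpow_lt_top_of_large {H a q : ℝ} (hb : ∀ t, AEMeasurable (b t) P)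
    (hmom : MomentBound P H b) (hH : 0 < H) (hq : 1 ≤ q) (hq' : 1 < (H - a) * q) :
    ∫⁻ ω, dyadicSup hT b a ω ^ q ∂P < ∞ := by
  obtain ⟨C, hC, hCb⟩ := hmom q hq
  have hq0 : 0 < q := by linarith
  set x : ℝ := 2 ^ (1 - (H - a) * q) with hx
  have hx0 : 0 < x := by positivity
  have hx1 : x < 1 := Real.rpow_lt_one_of_one_lt_of_neg (by norm_num) (by linarith)
  have hterm : ∀ n k : ℕ, ∫⁻ ω, dyadicIncrement hT b a n k ω ^ q ∂P ≤
      C * ENNReal.ofReal (((2 ^ n) ^ a) ^ q * (T * (2 ^ n)⁻¹) ^ (H * q)) := by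
    intro n k
    simp only [dyadicIncrement, ENNReal.mul_rpow_of_nonneg _ _ hq0.le]
    rw [lintegral_const_mul'' _ (((hb _).fun_sub (hb _)).enorm.pow_const q),
      ENNReal.ofReal_rpow_of_nonneg (by positivity) hq0.le, ENNReal.ofReal_mul (by positivity),
      mul_left_comm]
    gcongr
    refine (hCb _ _).trans ?_
    gcongr
    exact abs_dyadicPoint_succ_sub_le hT n k
  have hsum : ∀ n : ℕ, ∑ k ∈ Finset.range (2 ^ n), ∫⁻ ω, dyadicIncrement hT b a n k ω ^ q ∂P ≤
      C * ENNReal.ofReal (T ^ (H * q) * x ^ n) := by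
    intro n
    refine (Finset.sum_le_sum fun k _ => hterm n k).trans (le_of_eq ?_)
    rw [Finset.sum_const, Finset.card_range, nsmul_eq_mul, mul_left_comm]
    congr 1
    rw [← ENNReal.ofReal_natCast, ← ENNReal.ofReal_mul (by positivity)]
    congr 1
    have hX : (0 : ℝ) < 2 ^ n := by positivity
    have e1 : x ^ n = (2 ^ n) ^ (1 - (H - a) * q) := by
      rw [hx, ← Real.rpow_natCast, ← Real.rpow_natCast, ← Real.rpow_mul (by norm_num),
        ← Real.rpow_mul (by norm_num), mul_comm]
    rw [e1, Real.mul_rpow hT.le (by positivity), ← Real.rpow_mul hX.le, Real.inv_rpow hX.le,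
      ← Real.rpow_neg hX.le, show 1 - (H - a) * q = 1 + a * q + -(H * q) by ring,
      Real.rpow_add hX, Real.rpow_add hX, Real.rpow_one]
    push_cast
    ring
  have hsummable : Summable fun n : ℕ => T ^ (H * q) * x ^ n :=
    (summable_geometric_of_lt_one hx0.le hx1).mul_left _
  calc ∫⁻ ω, dyadicSup hT b a ω ^ q ∂P
      ≤ ∫⁻ ω, ∑' n : ℕ, ∑ k ∈ Finset.range (2 ^ n), dyadicIncrement hT b a n k ω ^ q ∂P :=
        lintegral_mono fun ω => dyadicSup_rpow_le hT a hq0 ω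
    _ = ∑' n : ℕ, ∑ k ∈ Finset.range (2 ^ n), ∫⁻ ω, dyadicIncrement hT b a n k ω ^ q ∂P := by
        rw [lintegral_tsum]
        · congr 1
          funext n
          rw [lintegral_finsetSum']
          exact fun k _ => (aemeasurable_dyadicIncrement hT hb a n k).pow_const q
        · exact fun n => Finset.aemeasurable_fun_sum _ fun k _ =>
            (aemeasurable_dyadicIncrement hT hb a n k).pow_const q
    _ ≤ ∑' n : ℕ, C * ENNReal.ofReal (T ^ (H * q) * x ^ n) := ENNReal.tsum_le_tsum hsum
    _ < ∞ := by
        rw [ENNReal.tsum_mul_left]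
        exact ENNReal.mul_lt_top hC.lt_top hsummable.tsum_ofReal_lt_top

lemma lintegral_dyadicSup_rpow_lt_top [IsProbabilityMeasure P] {H a q : ℝ}
    (hb : ∀ t, AEMeasurable (b t) P) (hmom : MomentBound P H b) (hH : 0 < H) (haH : a < H)
    (hq : 0 ≤ q) : ∫⁻ ω, dyadicSup hT b a ω ^ q ∂P < ∞ := by
  have hHa : 0 < H - a := sub_pos.2 haH
  -- This makes `(H-a) q' > 1`; the smaller power `q` is then controlled by `S^q ≤ 1 + S^{q'}`.
  set q' := max q (2 / (H - a) + 1) with hq'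
  have h1 : 1 ≤ q' := le_max_of_le_right (by have := div_pos two_pos hHa; linarith)
  have h2 : 1 < (H - a) * q' := by
    have : 2 / (H - a) + 1 ≤ q' := le_max_right _ _
    have h3 : (H - a) * (2 / (H - a) + 1) = 2 + (H - a) := by field_simp
    nlinarith
  have h3 := lintegral_dyadicSup_rpow_lt_top_of_large hT hb hmom hH h1 h2
  calc ∫⁻ ω, dyadicSup hT b a ω ^ q ∂P ≤ ∫⁻ ω, (1 + dyadicSup hT b a ω ^ q') ∂P := by
        refine lintegral_mono fun ω => ?_
        rcases le_total (dyadicSup hT b a ω) 1 with h | h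
        · exact (ENNReal.rpow_le_one h hq).trans le_self_add
        · exact (ENNReal.rpow_le_rpow_of_exponent_le h (le_max_left _ _)).trans le_add_self
    _ < ∞ := by
        rw [lintegral_add_left measurable_const]
        simpa using h3

/-- Identifies the chaining limit with `b t` at every `t`, not just at dyadic points: `b` has no
assumed path regularity, but the first moment bound gives convergence in `L¹`, hence almost surely
along a subsequence. -/
lemma tendsto_dyadicApprox_subseq [IsProbabilityMeasure P] {H : ℝ}
    (hb : ∀ t, AEMeasurable (b t) P) (hmom : MomentBound P H b) (hH : 0 < H)
    (t : Set.Icc (0 : ℝ) T) :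
    ∃ ns : ℕ → ℕ, StrictMono ns ∧ ∀ᵐ ω ∂P,
      Tendsto (fun i => dyadicApprox hT.le (fun s => b s ω) (ns i) t) atTop (𝓝 (b t ω)) := by
  refine TendstoInMeasure.exists_seq_tendsto_ae
    (f := fun n ω => dyadicApprox hT.le (fun s => b s ω) n t) (g := b t) ?_
  refine tendstoInMeasure_of_tendsto_eLpNorm one_ne_zero
    (fun n => (hb _).aestronglyMeasurable) (hb t).aestronglyMeasurable ?_
  obtain ⟨C, hC, hCb⟩ := hmom 1 le_rfl
  have hlim : Tendsto (fun n : ℕ => C * ENNReal.ofReal ((T * (1 / 2) ^ n) ^ (H * 1))) atTop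
      (𝓝 0) := by
    have h1 : Tendsto (fun n : ℕ => (T * (1 / 2) ^ n) ^ (H * 1)) atTop (𝓝 0) := by
      have h2 : Tendsto (fun n : ℕ => T * (1 / 2 : ℝ) ^ n) atTop (𝓝 0) := by
        simpa using (tendsto_pow_atTop_nhds_zero_of_lt_one (r := (1 / 2 : ℝ)) (by norm_num)
          (by norm_num)).const_mul T
      have := h2.rpow_const (p := H * 1) (Or.inr (by linarith))
      rwa [Real.zero_rpow (by linarith : H * 1 ≠ 0)] at this
    have h3 := ENNReal.Tendsto.const_mul (ENNReal.tendsto_ofReal h1) (Or.inr hC)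
    simpa using h3
  refine tendsto_of_tendsto_of_tendsto_of_le_of_le tendsto_const_nhds hlim (fun _ => zero_le)
    fun n => ?_
  rw [eLpNorm_one_eq_lintegral_enorm]
  have h := hCb (dyadicPoint hT.le n (dyadicIndex T n t)) t
  simp only [ENNReal.rpow_one] at h
  refine h.trans ?_
  gcongr
  exact abs_dyadicPoint_sub_le hT n t

/-- Kolmogorov's criterion: the process has a version all of whose paths are Hölder continuous,
and the Hölder constant has moments of all orders. -/
theorem exists_holder_version [IsProbabilityMeasure P] (hT : 0 < T) {H a : ℝ} (hb : ∀ t, AEMeasurable (b t) P)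
    (hmom : MomentBound P H b) (ha : 0 < a) (haH : a < H) :
    ∃ (x : Ω → ℝ → ℝ) (K : Ω → ℝ), (∀ ω, 0 ≤ K ω ∧ HolderBound (K ω) a (x ω)) ∧
      (∀ t : Set.Icc (0 : ℝ) T, (fun ω => x ω t) =ᵐ[P] b t) ∧ AEMeasurable K P ∧
      ∀ q : ℝ, 0 ≤ q → ∫⁻ ω, ENNReal.ofReal (K ω) ^ q ∂P < ∞ := by
  classical
  have hH : 0 < H := ha.trans haH
  set S := dyadicSup hT b a with hS
  set C : ℝ := (1 + 2 / (1 - (1 / 2) ^ a)) * 2 ^ a * T ^ (-a) with hC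
  have hr1 : (1 / 2 : ℝ) ^ a < 1 := Real.rpow_lt_one (by norm_num) (by norm_num) ha
  have hr0 : (0 : ℝ) < (1 / 2) ^ a := by positivity
  have hr1' : 0 < 1 - (1 / 2 : ℝ) ^ a := sub_pos.2 hr1
  have hC0 : 0 ≤ C := by positivity
  have hfin : ∀ᵐ ω ∂P, S ω < ∞ := by
    have := ae_lt_top' ((aemeasurable_dyadicSup hT hb a).pow_const 1)
      (lintegral_dyadicSup_rpow_lt_top hT hb hmom hH haH zero_le_one).ne
    simpa using this
  -- On the null set `S = ∞` the path is set to 0. There `(S ω).toReal = 0`, and the zero path is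
  -- Hölder with constant 0, so the Hölder bound holds for every `ω`.
  refine ⟨fun ω t => if S ω < ∞ then
    limUnder atTop fun n => dyadicApprox hT.le (fun s => b s ω) n t else 0,
    fun ω => C * (S ω).toReal, fun ω => ⟨by positivity, ?_⟩, fun t => ?_, ?_, fun q hq => ?_⟩
  · by_cases h : S ω < ∞
    · simp only [h, if_true]
      exact holderBound_limUnder_dyadicApprox hT ha (dyadicBound_of_dyadicSup_lt_top hT h)
        ENNReal.toReal_nonneg
    · simp only [h, if_false]
      intro u v
      simp only [sub_self, abs_zero]
      positivity
  · obtain ⟨ns, hns, hlim⟩ := tendsto_dyadicApprox_subseq hT hb hmom hH t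
    filter_upwards [hfin, hlim] with ω h1 h2
    simp only [h1, if_true]
    exact tendsto_nhds_unique ((tendsto_dyadicApprox hT
      (dyadicBound_of_dyadicSup_lt_top hT h1) ENNReal.toReal_nonneg hr0 hr1 t).comp
      hns.tendsto_atTop) h2
  · exact ((aemeasurable_dyadicSup hT hb a).ennreal_toReal).const_mul C
  · calc ∫⁻ ω, ENNReal.ofReal (C * (S ω).toReal) ^ q ∂P
        ≤ ∫⁻ ω, ENNReal.ofReal C ^ q * S ω ^ q ∂P := by
          refine lintegral_mono fun ω => ?_
          rw [← ENNReal.mul_rpow_of_nonneg _ _ hq, ENNReal.ofReal_mul hC0]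
          gcongr
          exact ENNReal.ofReal_toReal_le
      _ < ∞ := by
          rw [lintegral_const_mul'' _ ((aemeasurable_dyadicSup hT hb a).pow_const q)]
          exact ENNReal.mul_lt_top (ENNReal.rpow_lt_top_of_nonneg hq ENNReal.ofReal_ne_top)
            (lintegral_dyadicSup_rpow_lt_top hT hb hmom hH haH hq)

end

/-! ### Coordinates of a fractional Brownian motion -/

section

variable {Ω : Type*} [MeasurableSpace Ω] {P : Measure Ω} {H T : ℝ} {m : ℕ}
  {B : Set.Icc (0 : ℝ) T → Ω → EuclideanSpace ℝ (Fin m)}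

lemma IsFBM.isGaussianProcess_coord (hB : IsFBM P H T B) (i : Fin m) :
    IsGaussianProcess (fun t ω => B t ω i) P :=
  hB.gaussian.comp_left fun _ => EuclideanSpace.proj i

lemma IsFBM.memLp_coord (hB : IsFBM P H T B) (i : Fin m) (t : Set.Icc (0 : ℝ) T) :
    MemLp (fun ω => B t ω i) 2 P :=
  ((hB.isGaussianProcess_coord i).hasGaussianLaw_eval t).memLp_two

lemma IsFBM.integral_mul (hB : IsFBM P H T B) [IsProbabilityMeasure P] (i : Fin m)
    (s t : Set.Icc (0 : ℝ) T) :
    ∫ ω, B s ω i * B t ω i ∂P =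
      (|(t : ℝ)| ^ (2 * H) + |(s : ℝ)| ^ (2 * H) - |(t : ℝ) - (s : ℝ)| ^ (2 * H)) / 2 := by
  rw [← hB.covariance s t i, covariance_eq_sub (hB.memLp_coord i s) (hB.memLp_coord i t),
    hB.centered, hB.centered]
  simp

/-- An increment is a standard Gaussian scaled by `|s-t|^H`. Moments of every order therefore follow
from scaling, with the standard Gaussian moment as constant. -/
lemma IsFBM.map_sub (hB : IsFBM P H T B) [IsProbabilityMeasure P] (hH : 0 < H) (i : Fin m)
    (s t : Set.Icc (0 : ℝ) T) :
    P.map (fun ω => B s ω i - B t ω i) =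
      (gaussianReal 0 1).map (fun y => |(s : ℝ) - t| ^ H * y) := by
  have hs := hB.memLp_coord i s
  have ht := hB.memLp_coord i t
  rw [((hB.isGaussianProcess_coord i).hasGaussianLaw_fun_sub (s := s) (t := t)).map_eq_gaussianReal,
    gaussianReal_map_const_mul, mul_zero, mul_one]
  congr 1
  · rw [integral_sub (hs.integrable one_le_two) (ht.integrable one_le_two), hB.centered,
      hB.centered, sub_zero]
  · have hv : Var[fun ω => B s ω i - B t ω i; P] = (|(s : ℝ) - t| ^ H) ^ 2 := by
      rw [variance_fun_sub hs ht, ← covariance_self hs.aemeasurable,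
        ← covariance_self ht.aemeasurable, hB.covariance, hB.covariance, hB.covariance, sub_self,
        sub_self, abs_zero, Real.zero_rpow (by linarith), ← Real.rpow_natCast,
        ← Real.rpow_mul (abs_nonneg _), abs_sub_comm (t : ℝ) s, mul_comm H]
      push_cast
      ring
    ext
    rw [hv, Real.coe_toNNReal _ (by positivity)]
    rfl

lemma IsFBM.momentBound (hB : IsFBM P H T B) [IsProbabilityMeasure P] (hH : 0 < H) (i : Fin m) :
    MomentBound P H (fun t ω => B t ω i) := by
  intro q hq
  have hq0 : 0 < q := by linarith
  refine ⟨∫⁻ y, ‖y‖ₑ ^ q ∂(gaussianReal 0 1), ?_, fun s t => le_of_eq ?_⟩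
  · have := (memLp_id_gaussianReal' (μ := 0) (v := 1) (ENNReal.ofReal q)
      ENNReal.ofReal_ne_top).eLpNorm_lt_top
    have h2 := lintegral_rpow_enorm_lt_top_of_eLpNorm_lt_top
      (by simpa using hq0) ENNReal.ofReal_ne_top this
    rw [ENNReal.toReal_ofReal hq0.le] at h2
    exact h2.ne
  · have hm : AEMeasurable (fun ω => B s ω i - B t ω i) P :=
      (hB.memLp_coord i s).aemeasurable.sub (hB.memLp_coord i t).aemeasurable
    have hf : Measurable fun y : ℝ => ‖y‖ₑ ^ q := by fun_prop
    rw [← lintegral_map' (f := fun y : ℝ => ‖y‖ₑ ^ q) hf.aemeasurable hm, hB.map_sub hH,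
      lintegral_map hf (by fun_prop)]
    have : ∀ y : ℝ, ‖|(s : ℝ) - t| ^ H * y‖ₑ ^ q =
        ENNReal.ofReal (|(s : ℝ) - t| ^ (H * q)) * ‖y‖ₑ ^ q := by
      intro y
      rw [enorm_mul, ENNReal.mul_rpow_of_nonneg _ _ hq0.le, Real.enorm_of_nonneg (by positivity),
        ENNReal.ofReal_rpow_of_nonneg (by positivity) hq0.le, ← Real.rpow_mul (abs_nonneg _)]
    simp only [this]
    rw [lintegral_const_mul _ hf, mul_comm]

end

/-! ### The singular kernel `|u - v|^{2H-2}` -/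

lemma locallyIntegrable_abs_rpow {β : ℝ} (hβ : -1 < β) :
    LocallyIntegrable (fun x : ℝ => |x| ^ β) := by
  refine locallyIntegrable_of_norm_le_rpow (C := 1) (α := -β) (by simp) (by simp; linarith)
    (ae_of_all _ fun x => ?_) (by measurability : Measurable _).aestronglyMeasurable
  rw [Real.norm_eq_abs, Real.norm_eq_abs, neg_neg, one_mul, abs_of_nonneg (by positivity)]

lemma intervalIntegrable_abs_rpow {β : ℝ} (hβ : -1 < β) (a b : ℝ) :
    IntervalIntegrable (fun x : ℝ => |x| ^ β) volume a b :=
  ((locallyIntegrable_abs_rpow hβ).integrableOn_isCompact isCompact_uIcc).intervalIntegrable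

/-- Up to the factor `β + 1`, this is an antiderivative of `|x|^β`. Continuity across 0 lets the
fundamental theorem of calculus ignore the singular point. -/
lemma continuous_abs_rpow_mul {β : ℝ} (hβ : -1 < β) : Continuous fun x : ℝ => |x| ^ β * x := by
  refine continuous_iff_continuousAt.2 fun x => ?_
  by_cases hx : x = 0
  · subst hx
    rw [ContinuousAt, mul_zero]
    refine squeeze_zero_norm (a := fun x : ℝ => |x| ^ (β + 1)) (fun x => ?_) ?_
    · by_cases h : x = 0
      · simp [h]
        positivity
      · rw [norm_mul, Real.norm_eq_abs, Real.norm_eq_abs, abs_of_nonneg (by positivity),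
          Real.rpow_add_one (abs_ne_zero.2 h)]
    · have : Continuous fun x : ℝ => |x| ^ (β + 1) :=
        continuous_abs.rpow_const fun _ => Or.inr (by linarith)
      simpa [Real.zero_rpow (by linarith : β + 1 ≠ 0)] using this.tendsto 0
  · exact (continuousAt_id.abs.rpow_const (Or.inl (abs_ne_zero.2 hx))).mul continuousAt_id

lemma hasDerivAt_abs_rpow_mul {β x : ℝ} (hx : x ≠ 0) :
    HasDerivAt (fun x : ℝ => |x| ^ β * x) ((β + 1) * |x| ^ β) x := by
  rcases lt_or_gt_of_ne hx with h | h
  · have h1 : HasDerivAt (fun x : ℝ => -(-x) ^ (β + 1)) ((β + 1) * |x| ^ β) x := by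
      have := ((hasDerivAt_neg x).rpow_const (p := β + 1) (Or.inl (by linarith))).neg
      rw [abs_of_neg h]
      refine this.congr_deriv ?_
      rw [add_sub_cancel_right]
      ring
    refine h1.congr_of_eventuallyEq ?_
    filter_upwards [Iio_mem_nhds h] with y hy
    have hy : y < 0 := hy
    rw [abs_of_neg hy, Real.rpow_add_one (by linarith)]
    ring
  · have h1 : HasDerivAt (fun x : ℝ => x ^ (β + 1)) ((β + 1) * |x| ^ β) x := by
      have := (hasDerivAt_id x).rpow_const (p := β + 1) (Or.inl hx)
      rw [abs_of_pos h]
      refine this.congr_deriv ?_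
      rw [add_sub_cancel_right, one_mul, id]
    refine h1.congr_of_eventuallyEq ?_
    filter_upwards [Ioi_mem_nhds h] with y hy
    have hy : 0 < y := hy
    rw [abs_of_pos hy, Real.rpow_add_one hy.ne']

lemma integral_abs_rpow {β : ℝ} (hβ : -1 < β) (a b : ℝ) :
    ∫ x in a..b, |x| ^ β = (|b| ^ β * b - |a| ^ β * a) / (β + 1) := by
  have h := integral_eq_of_hasDerivAt_off_countable (fun x : ℝ => |x| ^ β * x)
    (fun x => (β + 1) * |x| ^ β) (a := a) (b := b) (Set.countable_singleton 0)
    (continuous_abs_rpow_mul hβ).continuousOn (fun x hx => hasDerivAt_abs_rpow_mul hx.2)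
    ((intervalIntegrable_abs_rpow hβ a b).const_mul _)
  rw [intervalIntegral.integral_const_mul] at h
  rw [← h]
  field_simp [show β + 1 ≠ 0 by linarith]

lemma integral_abs_rpow_mul {H : ℝ} (hH : 1 / 2 < H) (a b : ℝ) :
    ∫ x in a..b, |x| ^ (2 * H - 2) * x = (|b| ^ (2 * H) - |a| ^ (2 * H)) / (2 * H) := by
  rw [sub_div]
  refine intervalIntegral.integral_eq_sub_of_hasDerivAt
    (f := fun x => |x| ^ (2 * H) / (2 * H)) (fun x _ => ?_) ?_
  · have := (hasDerivAt_abs_rpow x (p := 2 * H) (by linarith)).div_const (2 * H)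
    refine this.congr_deriv ?_
    rw [mul_assoc, mul_div_cancel_left₀ _ (by linarith)]
  · exact (continuous_abs_rpow_mul (by linarith)).intervalIntegrable _ _

/-- The inner product on `ℋ` reproduces the covariance of the process: integrating the kernel twice
yields `|x|^{2H}`, and the prefactor `H(2H-1)` cancels the constants. -/
lemma integral_integral_abs_sub_rpow {H : ℝ} (hH : 1 / 2 < H) (s t : ℝ) :
    H * (2 * H - 1) * ∫ v in (0 : ℝ)..t, ∫ u in (0 : ℝ)..s, |u - v| ^ (2 * H - 2) =
      (|t| ^ (2 * H) + |s| ^ (2 * H) - |t - s| ^ (2 * H)) / 2 := by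
  have hβ : -1 < 2 * H - 2 := by linarith
  have hc := continuous_abs_rpow_mul hβ
  have h1 : ∀ v : ℝ, ∫ u in (0 : ℝ)..s, |u - v| ^ (2 * H - 2) =
      (|v| ^ (2 * H - 2) * v - |v - s| ^ (2 * H - 2) * (v - s)) / (2 * H - 1) := by
    intro v
    rw [intervalIntegral.integral_comp_sub_right (fun x => |x| ^ (2 * H - 2)) v,
      integral_abs_rpow hβ, zero_sub, abs_neg, abs_sub_comm s v]
    congr 1 <;> ring
  simp only [h1]
  have hc2 : Continuous fun v : ℝ => |v - s| ^ (2 * H - 2) * (v - s) :=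
    hc.comp (continuous_id.sub continuous_const)
  rw [intervalIntegral.integral_div, intervalIntegral.integral_sub
    (hc.intervalIntegrable _ _) (hc2.intervalIntegrable _ _),
    intervalIntegral.integral_comp_sub_right (fun x => |x| ^ (2 * H - 2) * x) s,
    integral_abs_rpow_mul hH, integral_abs_rpow_mul hH, zero_sub, abs_neg, abs_zero,
    Real.zero_rpow (by linarith)]
  have h2 : 2 * H - 1 ≠ 0 := by linarith
  have h3 : H ≠ 0 := by linarith
  rw [mul_assoc, mul_div_cancel₀ _ h2]
  field_simp
  ring

/-- Lebesgue measure on `[0,T]`. -/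
noncomputable abbrev intervalMeasure (T : ℝ) : Measure ℝ := volume.restrict (Set.Icc 0 T)

/-- For `v` in `[0,T]`, translation by `v` carries `[0,T]` into `[-T,T]`, so the inner integral is
bounded uniformly in `v`. -/
lemma lintegral_abs_sub_rpow_lt_top {β : ℝ} (hβ : -1 < β) (T : ℝ) :
    ∫⁻ v, ∫⁻ u, ENNReal.ofReal (|u - v| ^ β) ∂intervalMeasure T ∂intervalMeasure T < ∞ := by
  set C : ℝ≥0∞ := ∫⁻ x in Set.Icc (-T) T, ENNReal.ofReal (|x| ^ β) with hC
  have hCtop : C < ∞ := by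
    have h := (locallyIntegrable_abs_rpow hβ).integrableOn_isCompact
      (isCompact_Icc (a := -T) (b := T))
    exact h.lintegral_lt_top
  have hle : ∀ v ∈ Set.Icc 0 T, ∫⁻ u, ENNReal.ofReal (|u - v| ^ β) ∂intervalMeasure T ≤ C := by
    intro v hv
    rw [hC, ← lintegral_indicator measurableSet_Icc, ← lintegral_indicator measurableSet_Icc,
      ← lintegral_sub_right_eq_self (Set.indicator (Set.Icc (-T) T) _) v]
    refine lintegral_mono fun u => ?_
    by_cases hu : u ∈ Set.Icc 0 T
    · rw [Set.indicator_of_mem hu, Set.indicator_of_mem]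
      exact ⟨by linarith [hu.1, hv.2], by linarith [hu.2, hv.1]⟩
    · rw [Set.indicator_of_notMem hu]
      exact zero_le
  calc _ ≤ ∫⁻ _, C ∂intervalMeasure T :=
        lintegral_mono_ae ((ae_restrict_iff' measurableSet_Icc).2 (ae_of_all _ hle))
    _ < ∞ := by
        rw [lintegral_const, Measure.restrict_apply_univ]
        exact ENNReal.mul_lt_top hCtop measure_Icc_lt_top

lemma integrable_abs_sub_rpow {β : ℝ} (hβ : -1 < β) (T : ℝ) :
    Integrable (fun p : ℝ × ℝ => |p.2 - p.1| ^ β)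
      ((intervalMeasure T).prod (intervalMeasure T)) := by
  have hm : Measurable fun p : ℝ × ℝ => |p.2 - p.1| ^ β := by fun_prop
  refine ⟨hm.aestronglyMeasurable, ?_⟩
  rw [hasFiniteIntegral_iff_enorm, lintegral_prod _ hm.enorm.aemeasurable]
  refine lt_of_le_of_lt (le_of_eq ?_) (lintegral_abs_sub_rpow_lt_top hβ T)
  simp only [Real.enorm_of_nonneg (Real.rpow_nonneg (abs_nonneg _) _)]

/-- `f` is measurable and bounded by `M` almost everywhere on `[0,T]`. -/
def BoundedOn (T M : ℝ) (f : ℝ → ℝ) : Prop :=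
  AEStronglyMeasurable f (intervalMeasure T) ∧ ∀ᵐ u ∂intervalMeasure T, |f u| ≤ M

namespace BoundedOn

variable {T M M' : ℝ} {f g : ℝ → ℝ}

lemma add (hf : BoundedOn T M f) (hg : BoundedOn T M' g) : BoundedOn T (M + M') (f + g) := by
  refine ⟨hf.1.add hg.1, ?_⟩
  filter_upwards [hf.2, hg.2] with u h1 h2
  exact (abs_add_le _ _).trans (add_le_add h1 h2)

lemma sub (hf : BoundedOn T M f) (hg : BoundedOn T M' g) : BoundedOn T (M + M') (f - g) := by
  refine ⟨hf.1.sub hg.1, ?_⟩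
  filter_upwards [hf.2, hg.2] with u h1 h2
  exact (abs_sub _ _).trans (add_le_add h1 h2)

lemma ae_abs_mul_le (hf : BoundedOn T M f) (hg : BoundedOn T M' g) :
    ∀ᵐ p : ℝ × ℝ ∂(intervalMeasure T).prod (intervalMeasure T),
      |f p.2 * g p.1| ≤ M * M' := by
  filter_upwards [Measure.quasiMeasurePreserving_snd.ae hf.2,
    Measure.quasiMeasurePreserving_fst.ae hg.2] with p h1 h2
  rw [abs_mul]
  exact mul_le_mul h1 h2 (abs_nonneg _) ((abs_nonneg _).trans h1)

lemma integrable (hf : BoundedOn T M f) (hg : BoundedOn T M' g) {β : ℝ} (hβ : -1 < β) :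
    Integrable (fun p : ℝ × ℝ => f p.2 * g p.1 * |p.2 - p.1| ^ β)
      ((intervalMeasure T).prod (intervalMeasure T)) :=
  (integrable_abs_sub_rpow hβ T).bdd_mul
    ((hf.1.comp_quasiMeasurePreserving Measure.quasiMeasurePreserving_snd).mul
      (hg.1.comp_quasiMeasurePreserving Measure.quasiMeasurePreserving_fst))
    (hf.ae_abs_mul_le hg)

lemma innerH_eq (hf : BoundedOn T M f) (hg : BoundedOn T M' g) {H : ℝ} (hH : 1 / 2 < H) :
    innerH H T f g = H * (2 * H - 1) * ∫ p : ℝ × ℝ, f p.2 * g p.1 * |p.2 - p.1| ^ (2 * H - 2)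
      ∂(intervalMeasure T).prod (intervalMeasure T) := by
  rw [integral_prod _ (hf.integrable hg (by linarith)), innerH]

lemma innerH_add_left {M'' : ℝ} {k : ℝ → ℝ} (hf : BoundedOn T M f) (hg : BoundedOn T M' g)
    (hk : BoundedOn T M'' k) {H : ℝ} (hH : 1 / 2 < H) :
    innerH H T (f + g) k = innerH H T f k + innerH H T g k := by
  rw [(hf.add hg).innerH_eq hk hH, hf.innerH_eq hk hH, hg.innerH_eq hk hH, ← mul_add,
    ← integral_add (hf.integrable hk (by linarith)) (hg.integrable hk (by linarith))]
  simp only [Pi.add_apply, add_mul]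

lemma innerH_add_right {M'' : ℝ} {k : ℝ → ℝ} (hf : BoundedOn T M f) (hg : BoundedOn T M' g)
    (hk : BoundedOn T M'' k) {H : ℝ} (hH : 1 / 2 < H) :
    innerH H T k (f + g) = innerH H T k f + innerH H T k g := by
  rw [hk.innerH_eq (hf.add hg) hH, hk.innerH_eq hf hH, hk.innerH_eq hg hH, ← mul_add,
    ← integral_add (hk.integrable hf (by linarith)) (hk.integrable hg (by linarith))]
  simp only [Pi.add_apply, mul_add, add_mul]

/-- The parallelogram identity. -/
lemma innerH_add_add_innerH_sub (hf : BoundedOn T M f) (hg : BoundedOn T M' g)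
    {H : ℝ} (hH : 1 / 2 < H) :
    innerH H T (f + g) (f + g) + innerH H T (f - g) (f - g) =
      2 * innerH H T f f + 2 * innerH H T g g := by
  have hβ : -1 < 2 * H - 2 := by linarith
  have h : (∫ p : ℝ × ℝ, (f + g) p.2 * (f + g) p.1 * |p.2 - p.1| ^ (2 * H - 2)
        ∂(intervalMeasure T).prod (intervalMeasure T)) +
      (∫ p : ℝ × ℝ, (f - g) p.2 * (f - g) p.1 * |p.2 - p.1| ^ (2 * H - 2)
        ∂(intervalMeasure T).prod (intervalMeasure T)) =
      2 * (∫ p : ℝ × ℝ, f p.2 * f p.1 * |p.2 - p.1| ^ (2 * H - 2)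
        ∂(intervalMeasure T).prod (intervalMeasure T)) +
      2 * ∫ p : ℝ × ℝ, g p.2 * g p.1 * |p.2 - p.1| ^ (2 * H - 2)
        ∂(intervalMeasure T).prod (intervalMeasure T) := by
    rw [← integral_add ((hf.add hg).integrable (hf.add hg) hβ)
        ((hf.sub hg).integrable (hf.sub hg) hβ), ← integral_const_mul, ← integral_const_mul,
      ← integral_add ((hf.integrable hf hβ).const_mul 2) ((hg.integrable hg hβ).const_mul 2)]
    congr 1
    funext p
    simp only [Pi.add_apply, Pi.sub_apply]
    ring
  rw [(hf.add hg).innerH_eq (hf.add hg) hH, (hf.sub hg).innerH_eq (hf.sub hg) hH,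
    hf.innerH_eq hf hH, hg.innerH_eq hg hH, ← mul_add, h]
  ring

/-- The supremum norm controls the norm of `ℋ`; this is how uniform approximation by step functions
becomes approximation in `ℋ`. -/
lemma abs_innerH_le (hf : BoundedOn T M f) (hg : BoundedOn T M' g) {H : ℝ} (hH : 1 / 2 < H) :
    |innerH H T f g| ≤ H * (2 * H - 1) * (∫ p : ℝ × ℝ, |p.2 - p.1| ^ (2 * H - 2)
      ∂(intervalMeasure T).prod (intervalMeasure T)) * (M * M') := by
  have hβ : -1 < 2 * H - 2 := by linarith
  have hc : 0 ≤ H * (2 * H - 1) := mul_nonneg (by linarith) (by linarith)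
  rw [hf.innerH_eq hg hH, abs_mul, abs_of_nonneg hc, mul_assoc (H * (2 * H - 1)),
    ← integral_mul_const,
    ← Real.norm_eq_abs]
  gcongr
  refine norm_integral_le_of_norm_le ((integrable_abs_sub_rpow hβ T).mul_const _) ?_
  filter_upwards [hf.ae_abs_mul_le hg] with p hp
  rw [norm_mul, Real.norm_eq_abs, Real.norm_eq_abs,
    abs_of_nonneg (Real.rpow_nonneg (abs_nonneg _) _), mul_comm]
  gcongr

lemma memAbsH (hf : BoundedOn T M f) {H : ℝ} (hH : 1 / 2 < H) : MemAbsH H T f := by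
  have hβ : -1 < 2 * H - 2 := by linarith
  refine ⟨hf.1.aemeasurable, ?_⟩
  calc ∫⁻ v in Set.Icc 0 T, ∫⁻ u in Set.Icc 0 T,
        ENNReal.ofReal (|f u| * |f v| * |u - v| ^ (2 * H - 2))
      ≤ ∫⁻ v in Set.Icc 0 T, ∫⁻ u in Set.Icc 0 T,
        ENNReal.ofReal (M * M) * ENNReal.ofReal (|u - v| ^ (2 * H - 2)) := by
        refine lintegral_mono_ae ?_
        filter_upwards [hf.2] with v hv
        refine lintegral_mono_ae ?_
        filter_upwards [hf.2] with u hu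
        have hM : 0 ≤ M := (abs_nonneg _).trans hu
        rw [← ENNReal.ofReal_mul (by positivity)]
        gcongr
    _ < ∞ := by
        simp only [lintegral_const_mul' _ _ ENNReal.ofReal_ne_top]
        exact ENNReal.mul_lt_top ENNReal.ofReal_lt_top (lintegral_abs_sub_rpow_lt_top hβ T)

end BoundedOn

/-! ### Step functions -/

section

variable {T : ℝ}

lemma stepFun_eq (c : Set.Icc (0 : ℝ) T →₀ ℝ) (r : ℝ) :
    stepFun c r = Finsupp.linearCombination ℝ
      (fun t : Set.Icc (0 : ℝ) T => (Set.Icc (0 : ℝ) t).indicator (fun _ => (1 : ℝ)) r) c := by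
  simp [stepFun, Finsupp.linearCombination_apply]

lemma stepIntegral_eq {Ω : Type*} (b : Set.Icc (0 : ℝ) T → Ω → ℝ) (c : Set.Icc (0 : ℝ) T →₀ ℝ)
    (ω : Ω) : stepIntegral b c ω = Finsupp.linearCombination ℝ (fun t => b t ω) c := by
  simp [stepIntegral, Finsupp.linearCombination_apply]

lemma stepFun_add (c d : Set.Icc (0 : ℝ) T →₀ ℝ) : stepFun (c + d) = stepFun c + stepFun d := by
  funext r
  simp [stepFun_eq]

lemma stepFun_sub (c d : Set.Icc (0 : ℝ) T →₀ ℝ) : stepFun (c - d) = stepFun c - stepFun d := by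
  funext r
  simp [stepFun_eq]

lemma stepIntegral_sub {Ω : Type*} (b : Set.Icc (0 : ℝ) T → Ω → ℝ)
    (c d : Set.Icc (0 : ℝ) T →₀ ℝ) :
    stepIntegral b (c - d) = stepIntegral b c - stepIntegral b d := by
  funext r
  simp [stepIntegral_eq]

lemma boundedOn_indicator (t : ℝ) :
    BoundedOn T 1 ((Set.Icc (0 : ℝ) t).indicator fun _ => (1 : ℝ)) := by
  refine ⟨(measurable_const.indicator measurableSet_Icc).aestronglyMeasurable,
    ae_of_all _ fun u => ?_⟩
  by_cases h : u ∈ Set.Icc 0 t <;> simp [h]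

lemma exists_boundedOn_stepFun (c : Set.Icc (0 : ℝ) T →₀ ℝ) : ∃ M, BoundedOn T M (stepFun c) := by
  refine ⟨∑ t ∈ c.support, |c t|, ?_, ae_of_all _ fun u => ?_⟩
  · have : Measurable (stepFun c) := by
      unfold stepFun Finsupp.sum
      exact Finset.measurable_fun_sum _ fun t _ =>
        (measurable_const.indicator measurableSet_Icc).const_mul _
    exact this.aestronglyMeasurable
  · refine (Finset.abs_sum_le_sum_abs _ _).trans (Finset.sum_le_sum fun t _ => ?_)
    rw [abs_mul]
    refine mul_le_of_le_one_right (abs_nonneg _) ?_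
    by_cases h : u ∈ Set.Icc (0 : ℝ) t <;> simp [h]

lemma innerH_indicator {H : ℝ} (hH : 1 / 2 < H) (s t : Set.Icc (0 : ℝ) T) :
    innerH H T ((Set.Icc (0 : ℝ) s).indicator fun _ => (1 : ℝ))
      ((Set.Icc (0 : ℝ) t).indicator fun _ => (1 : ℝ)) =
      (|(t : ℝ)| ^ (2 * H) + |(s : ℝ)| ^ (2 * H) - |(t : ℝ) - (s : ℝ)| ^ (2 * H)) / 2 := by
  have key : ∀ (r : Set.Icc (0 : ℝ) T) (φ : ℝ → ℝ),
      ∫ v in Set.Icc 0 T, (Set.Icc (0 : ℝ) r).indicator (fun _ => (1 : ℝ)) v * φ v =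
      ∫ v in (0 : ℝ)..r, φ v := by
    intro r φ
    have h1 : (fun v => (Set.Icc (0 : ℝ) r).indicator (fun _ => (1 : ℝ)) v * φ v) =
        (Set.Icc (0 : ℝ) r).indicator φ := by
      funext v
      by_cases h : v ∈ Set.Icc (0 : ℝ) r
      · rw [Set.indicator_of_mem h, Set.indicator_of_mem h, one_mul]
      · rw [Set.indicator_of_notMem h, Set.indicator_of_notMem h, zero_mul]
    rw [h1, setIntegral_indicator measurableSet_Icc,
      Set.inter_eq_self_of_subset_right (Set.Icc_subset_Icc_right r.2.2),
      integral_Icc_eq_integral_Ioc, intervalIntegral.integral_of_le r.2.1]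
  rw [← integral_integral_abs_sub_rpow hH, innerH]
  congr 1
  rw [← key t]
  congr 1
  funext v
  rw [← key s, ← integral_const_mul]
  congr 1
  funext u
  ring

variable {Ω : Type*} [MeasurableSpace Ω] {P : Measure Ω} {H : ℝ} {b : Set.Icc (0 : ℝ) T → Ω → ℝ}

/-- `b` is square integrable with the second moments of a fractional Brownian motion. -/
def HasFBMCovariance (P : Measure Ω) (H : ℝ) (b : Set.Icc (0 : ℝ) T → Ω → ℝ) : Prop :=
  (∀ t, MemLp (b t) 2 P) ∧ ∀ s t : Set.Icc (0 : ℝ) T, ∫ ω, b s ω * b t ω ∂P =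
    (|(t : ℝ)| ^ (2 * H) + |(s : ℝ)| ^ (2 * H) - |(t : ℝ) - (s : ℝ)| ^ (2 * H)) / 2

lemma memLp_stepIntegral (hb : HasFBMCovariance P H b) (c : Set.Icc (0 : ℝ) T →₀ ℝ) :
    MemLp (stepIntegral b c) 2 P :=
  memLp_finsetSum _ fun t _ => (hb.1 t).const_mul (c t)

/-- The isometry property of the Wiener integral on step functions. -/
lemma integral_stepIntegral_sq (hb : HasFBMCovariance P H b) (hH : 1 / 2 < H)
    (c : Set.Icc (0 : ℝ) T →₀ ℝ) :
    ∫ ω, stepIntegral b c ω ^ 2 ∂P = innerH H T (stepFun c) (stepFun c) := by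
  obtain ⟨M, hM⟩ := exists_boundedOn_stepFun c
  have hβ : -1 < 2 * H - 2 := by linarith
  have h1 : ∫ ω, stepIntegral b c ω ^ 2 ∂P = ∑ s ∈ c.support, ∑ t ∈ c.support, c s * c t *
      ((|(t : ℝ)| ^ (2 * H) + |(s : ℝ)| ^ (2 * H) - |(t : ℝ) - (s : ℝ)| ^ (2 * H)) / 2) := by
    have e : ∀ ω, stepIntegral b c ω ^ 2 =
        ∑ s ∈ c.support, ∑ t ∈ c.support, c s * c t * (b s ω * b t ω) := by
      intro ω
      rw [sq, stepIntegral, Finsupp.sum, Finset.sum_mul_sum]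
      exact Finset.sum_congr rfl fun s _ => Finset.sum_congr rfl fun t _ => by ring
    simp only [e]
    have hi : ∀ s t, Integrable (fun ω => c s * c t * (b s ω * b t ω)) P := fun s t =>
      ((hb.1 s).integrable_mul (hb.1 t)).const_mul _
    rw [integral_finsetSum _ fun s _ => integrable_finsetSum _ fun t _ => hi s t]
    refine Finset.sum_congr rfl fun s _ => ?_
    rw [integral_finsetSum _ fun t _ => hi s t]
    refine Finset.sum_congr rfl fun t _ => ?_
    rw [integral_const_mul, hb.2]
  rw [h1, hM.innerH_eq hM hH]
  have e : ∀ p : ℝ × ℝ, stepFun c p.2 * stepFun c p.1 * |p.2 - p.1| ^ (2 * H - 2) =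
      ∑ s ∈ c.support, ∑ t ∈ c.support, c s * c t *
        ((Set.Icc (0 : ℝ) s).indicator (fun _ => (1 : ℝ)) p.2 *
          (Set.Icc (0 : ℝ) t).indicator (fun _ => (1 : ℝ)) p.1 * |p.2 - p.1| ^ (2 * H - 2)) := by
    intro p
    rw [stepFun, stepFun, Finsupp.sum, Finsupp.sum, Finset.sum_mul_sum, Finset.sum_mul]
    refine Finset.sum_congr rfl fun s _ => ?_
    rw [Finset.sum_mul]
    exact Finset.sum_congr rfl fun t _ => by ring
  simp only [e]
  have hi : ∀ s t : Set.Icc (0 : ℝ) T, Integrable (fun p : ℝ × ℝ => c s * c t *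
      ((Set.Icc (0 : ℝ) s).indicator (fun _ => (1 : ℝ)) p.2 *
        (Set.Icc (0 : ℝ) t).indicator (fun _ => (1 : ℝ)) p.1 * |p.2 - p.1| ^ (2 * H - 2)))
      ((intervalMeasure T).prod (intervalMeasure T)) := fun s t =>
    ((boundedOn_indicator s).integrable (boundedOn_indicator t) hβ).const_mul _
  rw [integral_finsetSum _ fun s _ => integrable_finsetSum _ fun t _ => hi s t, Finset.mul_sum]
  refine Finset.sum_congr rfl fun s _ => ?_
  rw [integral_finsetSum _ fun t _ => hi s t, Finset.mul_sum]
  refine Finset.sum_congr rfl fun t _ => ?_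
  rw [integral_const_mul, ← innerH_indicator hH,
    (boundedOn_indicator s).innerH_eq (boundedOn_indicator t) hH]
  ring

end

/-! ### Uniqueness of the Wiener integral -/

/-- `h` is a uniform limit of step functions, almost everywhere on `[0,T]`. -/
def StepApproximable (T : ℝ) (h : ℝ → ℝ) : Prop :=
  ∀ ε > 0, ∃ c : Set.Icc (0 : ℝ) T →₀ ℝ, ∀ᵐ u ∂intervalMeasure T, |h u - stepFun c u| ≤ ε

section

variable {Ω : Type*} [MeasurableSpace Ω] {P : Measure Ω} {H T M : ℝ}
  {b : Set.Icc (0 : ℝ) T → Ω → ℝ} {h : ℝ → ℝ}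

lemma StepApproximable.add_self_sub_stepFun (ha : StepApproximable T h)
    (c : Set.Icc (0 : ℝ) T →₀ ℝ) : StepApproximable T (h + h - stepFun c) := by
  intro ε hε
  obtain ⟨e, he⟩ := ha (ε / 2) (by positivity)
  refine ⟨e + e - c, ?_⟩
  filter_upwards [he] with u hu
  rw [stepFun_sub, stepFun_add]
  simp only [Pi.add_apply, Pi.sub_apply]
  rw [show h u + h u - stepFun c u - (stepFun e u + stepFun e u - stepFun c u) =
    2 * (h u - stepFun e u) by ring, abs_mul, abs_two]
  linarith

/-- Positivity comes from probability: on step functions the form is the second moment of a Wiener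
integral. It passes to uniform limits because the form is continuous for the supremum norm. -/
lemma innerH_self_nonneg (hb : HasFBMCovariance P H b) (hH : 1 / 2 < H) (hM : BoundedOn T M h)
    (ha : StepApproximable T h) : 0 ≤ innerH H T h h := by
  set E : ℝ := H * (2 * H - 1) * (∫ p : ℝ × ℝ, |p.2 - p.1| ^ (2 * H - 2)
      ∂(intervalMeasure T).prod (intervalMeasure T)) with hE
  have hbound : ∀ ε > 0, -(E * ((M + ε) * ε)) - E * (ε * M) ≤ innerH H T h h := by
    intro ε hε
    obtain ⟨c, hc⟩ := ha ε hε
    obtain ⟨Mc, hMc⟩ := exists_boundedOn_stepFun c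
    have hd : BoundedOn T ε (h - stepFun c) := ⟨hM.1.sub hMc.1, hc⟩
    have hp : BoundedOn T (M + ε) (stepFun c) := by
      simpa using hM.sub hd
    have e : stepFun c + (h - stepFun c) = h := by abel
    have h1 : innerH H T h h = innerH H T (stepFun c) (stepFun c) +
        innerH H T (stepFun c) (h - stepFun c) + innerH H T (h - stepFun c) h := by
      rw [← hp.innerH_add_right hd hp hH, e, ← hp.innerH_add_left hd hM hH, e]
    have h2 : 0 ≤ innerH H T (stepFun c) (stepFun c) := by
      rw [← integral_stepIntegral_sq hb hH]
      exact integral_nonneg fun _ => sq_nonneg _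
    have h3 := (abs_le.1 (hp.abs_innerH_le hd hH)).1
    have h4 := (abs_le.1 (hd.abs_innerH_le hM hH)).1
    rw [h1]
    linarith
  have hlim : Tendsto (fun ε : ℝ => -(E * ((M + ε) * ε)) - E * (ε * M)) (𝓝[>] 0) (𝓝 0) := by
    have : Continuous fun ε : ℝ => -(E * ((M + ε) * ε)) - E * (ε * M) := by fun_prop
    have h1 := this.tendsto 0
    simp only [mul_zero, zero_mul, neg_zero, sub_zero] at h1
    exact h1.mono_left nhdsWithin_le_nhds
  exact le_of_tendsto hlim (eventually_nhdsWithin_of_forall fun ε hε => hbound ε hε)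

lemma eLpNorm_stepIntegral (hb : HasFBMCovariance P H b) (hH : 1 / 2 < H)
    (c : Set.Icc (0 : ℝ) T →₀ ℝ) :
    eLpNorm (stepIntegral b c) 2 P =
      ENNReal.ofReal (innerH H T (stepFun c) (stepFun c) ^ (2 : ℝ)⁻¹) := by
  rw [(memLp_stepIntegral hb c).eLpNorm_eq_integral_rpow_norm two_ne_zero ENNReal.ofNat_ne_top,
    ← integral_stepIntegral_sq hb hH]
  simp

/-- The Wiener integral is determined up to a null set. -/
lemma IsWienerIntegral.ae_eq {X X' : Ω → ℝ} (hb : HasFBMCovariance P H b) (hH : 1 / 2 < H)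
    (hM : BoundedOn T M h) (ha : StepApproximable T h) (hX : IsWienerIntegral P H T b h X)
    (hX' : IsWienerIntegral P H T b h X') : X =ᵐ[P] X' := by
  obtain ⟨-, hXL, c, hc, hcX⟩ := hX
  obtain ⟨-, hXL', c', hc', hcX'⟩ := hX'
  -- The parallelogram identity for `h - stepFun (c n)` and `h - stepFun (c' n)`: their difference
  -- is a step function, and the squared norm of their sum is dropped because it is nonnegative. No
  -- Cauchy–Schwarz inequality for `ℋ` is needed.
  have hle : ∀ n, innerH H T (stepFun (c' n - c n)) (stepFun (c' n - c n)) ≤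
      2 * innerH H T (h - stepFun (c n)) (h - stepFun (c n)) +
        2 * innerH H T (h - stepFun (c' n)) (h - stepFun (c' n)) := by
    intro n
    obtain ⟨N, hN⟩ := exists_boundedOn_stepFun (c n)
    obtain ⟨N', hN'⟩ := exists_boundedOn_stepFun (c' n)
    have hpar := (hM.sub hN).innerH_add_add_innerH_sub (hM.sub hN') hH
    have e1 : h - stepFun (c n) - (h - stepFun (c' n)) = stepFun (c' n - c n) := by
      rw [stepFun_sub]; abel
    have e2 : h - stepFun (c n) + (h - stepFun (c' n)) = h + h - stepFun (c n + c' n) := by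
      rw [stepFun_add]; abel
    obtain ⟨N'', hN''⟩ := exists_boundedOn_stepFun (c n + c' n)
    have hpos := innerH_self_nonneg hb hH ((hM.add hM).sub hN'')
      (ha.add_self_sub_stepFun (c n + c' n))
    rw [e1, e2] at hpar
    linarith
  have hmid : Tendsto (fun n => eLpNorm (stepIntegral b (c' n - c n)) 2 P) atTop (𝓝 0) := by
    have h1 : Tendsto (fun n => 2 * innerH H T (h - stepFun (c n)) (h - stepFun (c n)) +
        2 * innerH H T (h - stepFun (c' n)) (h - stepFun (c' n))) atTop (𝓝 0) := by
      simpa using (hc.const_mul 2).add (hc'.const_mul 2)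
    have h2 : ∀ n, 0 ≤ innerH H T (stepFun (c' n - c n)) (stepFun (c' n - c n)) := by
      intro n
      rw [← integral_stepIntegral_sq hb hH]
      exact integral_nonneg fun _ => sq_nonneg _
    have h3 := (squeeze_zero h2 hle h1).rpow_const (p := (2 : ℝ)⁻¹) (Or.inr (by norm_num))
    rw [Real.zero_rpow (by norm_num)] at h3
    simp only [eLpNorm_stepIntegral hb hH]
    simpa using ENNReal.tendsto_ofReal h3
  have hzero : eLpNorm (X - X') 2 P = 0 := by
    refine le_antisymm (ge_of_tendsto' (x := atTop) (f := fun n =>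
      eLpNorm (X - stepIntegral b (c n)) 2 P + eLpNorm (stepIntegral b (c' n - c n)) 2 P +
        eLpNorm (X' - stepIntegral b (c' n)) 2 P) ?_ fun n => ?_) zero_le
    · simpa using (hcX.add hmid).add hcX'
    · have e : X - X' = (X - stepIntegral b (c n)) - stepIntegral b (c' n - c n) -
          (X' - stepIntegral b (c' n)) := by
        rw [stepIntegral_sub]; abel
      have hm := (memLp_stepIntegral hb (c n)).1
      have hm' := (memLp_stepIntegral hb (c' n)).1
      have hm'' := (memLp_stepIntegral hb (c' n - c n)).1
      rw [e]
      refine (eLpNorm_sub_le ((hXL.1.sub hm).sub hm'') (hXL'.1.sub hm') one_le_two).trans ?_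
      gcongr
      exact eLpNorm_sub_le (hXL.1.sub hm) hm'' one_le_two
  rw [eLpNorm_eq_zero_iff (hXL.1.sub hXL'.1) two_ne_zero] at hzero
  filter_upwards [hzero] with ω hω
  exact sub_eq_zero.1 hω

end

/-! ### Riemann sums as integrals of step functions -/

section

variable {T γ s t τ : ℝ} (hT : 0 ≤ T)

/-- The coefficients of the step function that takes the value `(τ-t_k)^{-γ}` on
`(t_k, t_{k+1}]`, where `t_0 < … < t_n` is the uniform partition of `[s,t]`. -/
noncomputable def riemannStep (γ s t τ : ℝ) (n : ℕ) : Set.Icc (0 : ℝ) T →₀ ℝ :=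
  ∑ k ∈ Finset.range n,
    (Finsupp.single (Set.projIcc 0 T hT (partitionPoint s t n (k + 1)))
        ((τ - partitionPoint s t n k) ^ (-γ)) -
      Finsupp.single (Set.projIcc 0 T hT (partitionPoint s t n k))
        ((τ - partitionPoint s t n k) ^ (-γ)))

lemma stepIntegral_riemannStep {Ω : Type*} (b : Set.Icc (0 : ℝ) T → Ω → ℝ) (n : ℕ) (ω : Ω) :
    stepIntegral b (riemannStep hT γ s t τ n) ω =
      ∑ k ∈ Finset.range n, (τ - partitionPoint s t n k) ^ (-γ) *
        (b (Set.projIcc 0 T hT (partitionPoint s t n (k + 1))) ω -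
          b (Set.projIcc 0 T hT (partitionPoint s t n k)) ω) := by
  rw [stepIntegral_eq, riemannStep, map_sum]
  refine Finset.sum_congr rfl fun k _ => ?_
  rw [map_sub, Finsupp.linearCombination_single, Finsupp.linearCombination_single, smul_eq_mul,
    smul_eq_mul, mul_sub]

lemma stepFun_riemannStep (hs : 0 ≤ s) (hst : s ≤ t) (ht : t ≤ T) {n : ℕ} (hn : n ≠ 0) (r : ℝ) :
    stepFun (riemannStep hT γ s t τ n) r =
      ∑ k ∈ Finset.range n, (τ - partitionPoint s t n k) ^ (-γ) *
        ((Set.Icc (0 : ℝ) (partitionPoint s t n (k + 1))).indicator (fun _ => (1 : ℝ)) r -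
          (Set.Icc (0 : ℝ) (partitionPoint s t n k)).indicator (fun _ => (1 : ℝ)) r) := by
  rw [stepFun_eq, riemannStep, map_sum]
  refine Finset.sum_congr rfl fun k hk => ?_
  have hk := Finset.mem_range.1 hk
  have hmem : ∀ j ≤ n, partitionPoint s t n j ∈ Set.Icc 0 T := fun j hj =>
    Set.Icc_subset_Icc hs ht (partitionPoint_mem hst hj hn)
  rw [map_sub, Finsupp.linearCombination_single, Finsupp.linearCombination_single, smul_eq_mul,
    smul_eq_mul, Set.projIcc_of_mem hT (hmem k hk.le), Set.projIcc_of_mem hT (hmem (k + 1) hk),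
    mul_sub]

/-- For `r` in `(s,t]` the differences of consecutive indicators sum to 1 and single out the cell
`(t_k, t_{k+1}]` containing `r`; the error there is the variation of the kernel over part of one
cell. The point `r = s` is excluded because the kernel is supported on the closed interval, while
the step function vanishes at `s`. -/
lemma abs_kernel_sub_stepFun_le (hγ : 0 < γ) (hγ1 : γ ≤ 1) (hs : 0 ≤ s) (hst : s ≤ t)
    (htτ : t < τ) (ht : t ≤ T) {n : ℕ} (hn : n ≠ 0) {r : ℝ} (hr0 : 0 ≤ r) (hrs : r ≠ s) :
    |kernel γ s t τ r - stepFun (riemannStep hT γ s t τ n) r| ≤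
      (t - s) / n * (τ - t) ^ (-γ - 1) := by
  have hτt : 0 < τ - t := sub_pos.2 htτ
  have hδ : 0 ≤ (t - s) / n := div_nonneg (sub_nonneg.2 hst) n.cast_nonneg
  rw [stepFun_riemannStep hT hs hst ht hn]
  set χ : ℕ → ℝ := fun k =>
    (Set.Icc (0 : ℝ) (partitionPoint s t n k)).indicator (fun _ => (1 : ℝ)) r with hχ
  have hχ1 : ∀ k, r ≤ partitionPoint s t n k → χ k = 1 := fun k hk =>
    Set.indicator_of_mem (show r ∈ Set.Icc 0 _ from ⟨hr0, hk⟩) _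
  have hχ0 : ∀ k, partitionPoint s t n k < r → χ k = 0 := fun k hk =>
    Set.indicator_of_notMem (fun h => hk.not_ge h.2) _
  by_cases hr : r ∈ Set.Icc s t
  · have hsr : s < r := lt_of_le_of_ne hr.1 (Ne.symm hrs)
    have htel : ∑ k ∈ Finset.range n, (χ (k + 1) - χ k) = 1 := by
      rw [Finset.sum_range_sub, hχ1 n (by rw [partitionPoint_self s t hn]; exact hr.2),
        hχ0 0 (by rwa [partitionPoint_zero]), sub_zero]
    rw [kernel, Set.indicator_of_mem hr]
    have e : (τ - r) ^ (-γ) - ∑ k ∈ Finset.range n,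
        (τ - partitionPoint s t n k) ^ (-γ) * (χ (k + 1) - χ k) =
        ∑ k ∈ Finset.range n,
          ((τ - r) ^ (-γ) - (τ - partitionPoint s t n k) ^ (-γ)) * (χ (k + 1) - χ k) := by
      simp only [sub_mul _ _ (χ _ - χ _)]
      rw [Finset.sum_sub_distrib, ← Finset.mul_sum, htel, mul_one]
    change |(τ - r) ^ (-γ) - ∑ k ∈ Finset.range n,
        (τ - partitionPoint s t n k) ^ (-γ) * (χ (k + 1) - χ k)| ≤ _
    rw [e]
    calc _ ≤ ∑ k ∈ Finset.range n, |((τ - r) ^ (-γ) - (τ - partitionPoint s t n k) ^ (-γ)) *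
            (χ (k + 1) - χ k)| := Finset.abs_sum_le_sum_abs _ _
      _ ≤ ∑ k ∈ Finset.range n, (t - s) / n * (τ - t) ^ (-γ - 1) * (χ (k + 1) - χ k) := by
          refine Finset.sum_le_sum fun k _ => ?_
          have hmono := partitionPoint_mono hst n k.le_succ
          rcases le_or_gt r (partitionPoint s t n k) with h1 | h1
          · rw [hχ1 k h1, hχ1 (k + 1) (h1.trans hmono)]
            simp
          rcases le_or_gt r (partitionPoint s t n (k + 1)) with h2 | h2
          · rw [hχ0 k h1, hχ1 (k + 1) h2, sub_zero, mul_one, mul_one]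
            have hτr : 0 < τ - r := by linarith [hr.2]
            have h3 := rpow_neg_sub_rpow_neg_le hτr (sub_pos.2 h1) hγ zero_le_one le_rfl
            rw [sub_add_sub_cancel, max_eq_left hγ1, one_mul, Real.rpow_one] at h3
            rw [abs_of_nonneg (sub_nonneg.2
              (Real.rpow_le_rpow_of_nonpos hτr (by linarith) (by linarith)))]
            refine h3.trans (mul_le_mul ?_ ?_ (by positivity) hδ)
            · linarith [partitionPoint_succ_sub s t n k]
            · exact Real.rpow_le_rpow_of_nonpos hτt (by linarith [hr.2]) (by linarith)
          · rw [hχ0 k h1, hχ0 (k + 1) h2]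
            simp
      _ = (t - s) / n * (τ - t) ^ (-γ - 1) := by rw [← Finset.mul_sum, htel, mul_one]
  · rw [kernel, Set.indicator_of_notMem hr]
    have hz : ∑ k ∈ Finset.range n, (τ - partitionPoint s t n k) ^ (-γ) * (χ (k + 1) - χ k) = 0 := by
      refine Finset.sum_eq_zero fun k hk => ?_
      have hk := Finset.mem_range.1 hk
      rcases lt_or_ge r s with h | h
      · rw [hχ1 k (h.le.trans (partitionPoint_mem hst hk.le hn).1),
          hχ1 (k + 1) (h.le.trans (partitionPoint_mem hst hk hn).1), sub_self, mul_zero]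
      · have h' : t < r := lt_of_not_ge fun h' => hr ⟨h, h'⟩
        rw [hχ0 k ((partitionPoint_mem hst hk.le hn).2.trans_lt h'),
          hχ0 (k + 1) ((partitionPoint_mem hst hk hn).2.trans_lt h'), sub_self, mul_zero]
    change |0 - ∑ k ∈ Finset.range n,
        (τ - partitionPoint s t n k) ^ (-γ) * (χ (k + 1) - χ k)| ≤ _
    rw [hz, sub_zero, abs_zero]
    positivity

lemma ae_abs_kernel_sub_stepFun_le (hγ : 0 < γ) (hγ1 : γ ≤ 1) (hs : 0 ≤ s) (hst : s ≤ t)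
    (htτ : t < τ) (ht : t ≤ T) {n : ℕ} (hn : n ≠ 0) :
    ∀ᵐ r ∂intervalMeasure T, |kernel γ s t τ r - stepFun (riemannStep hT γ s t τ n) r| ≤
      (t - s) / n * (τ - t) ^ (-γ - 1) := by
  have h1 : ∀ᵐ r ∂intervalMeasure T, r ≠ s :=
    ae_restrict_of_ae (by simp [ae_iff])
  filter_upwards [h1, ae_restrict_mem measurableSet_Icc] with r hr1 hr2
  exact abs_kernel_sub_stepFun_le hT hγ hγ1 hs hst htτ ht hn hr2.1 hr1

lemma tendsto_partition_mesh (s t : ℝ) :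
    Tendsto (fun n : ℕ => (t - s) / ((n + 1 : ℕ) : ℝ)) atTop (𝓝 0) :=
  (tendsto_const_div_atTop_nhds_zero_nat (t - s)).comp (tendsto_add_atTop_nat 1)

lemma boundedOn_kernel (hγ : 0 < γ) (htτ : t < τ) :
    BoundedOn T ((τ - t) ^ (-γ)) (kernel γ s t τ) := by
  have hm : Measurable fun r : ℝ => (τ - r) ^ (-γ) := by measurability
  refine ⟨(hm.indicator measurableSet_Icc).aestronglyMeasurable, ae_of_all _ fun r => ?_⟩
  have hτt : 0 < τ - t := sub_pos.2 htτ
  by_cases hr : r ∈ Set.Icc s t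
  · rw [kernel, Set.indicator_of_mem hr,
      abs_of_nonneg (Real.rpow_nonneg (by linarith [hr.2]) _)]
    exact Real.rpow_le_rpow_of_nonpos hτt (by linarith [hr.2]) (by linarith)
  · rw [kernel, Set.indicator_of_notMem hr, abs_zero]
    positivity

lemma stepApproximable_kernel (hγ : 0 < γ) (hγ1 : γ ≤ 1) (hs : 0 ≤ s) (hst : s ≤ t)
    (htτ : t < τ) (ht : t ≤ T) : StepApproximable T (kernel γ s t τ) := by
  intro ε hε
  have hT : 0 ≤ T := (hs.trans hst).trans ht
  have hlim := (tendsto_partition_mesh s t).mul_const ((τ - t) ^ (-γ - 1))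
  rw [zero_mul] at hlim
  obtain ⟨n, hn⟩ := (hlim.eventually (gt_mem_nhds hε)).exists
  refine ⟨riemannStep hT γ s t τ (n + 1), ?_⟩
  filter_upwards [ae_abs_kernel_sub_stepFun_le hT hγ hγ1 hs hst htτ ht n.succ_ne_zero] with r hr
  exact hr.trans hn.le

/-- The pathwise integral against a Hölder continuous version is the Wiener integral. -/
lemma isWienerIntegral_pathIntegral {Ω : Type*} [MeasurableSpace Ω] {P : Measure Ω} {H a : ℝ}
    {b : Set.Icc (0 : ℝ) T → Ω → ℝ} {x : Ω → ℝ → ℝ} {K : Ω → ℝ}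
    (hb : HasFBMCovariance P H b) (hH : 1 / 2 < H) (ha : 0 < a)
    (hx : ∀ ω, 0 ≤ K ω ∧ HolderBound (K ω) a (x ω))
    (hxb : ∀ r : Set.Icc (0 : ℝ) T, (fun ω => x ω r) =ᵐ[P] b r) (hK : MemLp K 2 P)
    (hγ : 0 < γ) (hγ1 : γ ≤ 1) (hs : 0 ≤ s) (hst : s ≤ t) (htτ : t < τ) (ht : t ≤ T) :
    IsWienerIntegral P H T b (kernel γ s t τ) (fun ω => pathIntegral γ (x ω) s t τ) := by
  have hT : 0 ≤ T := (hs.trans hst).trans ht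
  set X : Ω → ℝ := fun ω => pathIntegral γ (x ω) s t τ with hX
  set I : ℕ → Ω → ℝ := fun n => stepIntegral b (riemannStep hT γ s t τ (n + 1)) with hI
  set ε : ℕ → ℝ := fun n => ((t - s) / ((n + 1 : ℕ) : ℝ)) ^ a * (τ - t) ^ (-γ) with hε
  have hτt : 0 < τ - t := sub_pos.2 htτ
  have hmesh := tendsto_partition_mesh s t
  have hεlim : Tendsto ε atTop (𝓝 0) := by
    have := (hmesh.rpow_const (p := a) (Or.inr ha.le)).mul_const ((τ - t) ^ (-γ))
    rwa [Real.zero_rpow ha.ne', zero_mul] at this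
  -- A Riemann sum sees only finitely many times, so almost surely `x` may be replaced by `b` in it.
  -- The index `n + 1` avoids the empty partition.
  have hbd : ∀ n, ∀ᵐ ω ∂P, |X ω - I n ω| ≤ ε n * K ω := by
    intro n
    have hall : ∀ᵐ ω ∂P, ∀ k ∈ Finset.range (n + 2),
        x ω (Set.projIcc 0 T hT (partitionPoint s t (n + 1) k)) =
          b (Set.projIcc 0 T hT (partitionPoint s t (n + 1) k)) ω :=
      (ae_ball_iff (Finset.range (n + 2)).countable_toSet).2 fun k _ => hxb _
    filter_upwards [hall] with ω hω
    have hR : I n ω = riemannSum γ (x ω) s t τ (n + 1) := by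
      simp only [hI]
      rw [stepIntegral_riemannStep, riemannSum]
      refine Finset.sum_congr rfl fun k hk => ?_
      have hk := Finset.mem_range.1 hk
      have hmem : ∀ j ≤ n + 1, partitionPoint s t (n + 1) j ∈ Set.Icc 0 T := fun j hj =>
        Set.Icc_subset_Icc hs ht (partitionPoint_mem hst hj n.succ_ne_zero)
      rw [← hω k (Finset.mem_range.2 (by omega)), ← hω (k + 1) (Finset.mem_range.2 (by omega)),
        Set.projIcc_of_mem hT (hmem k hk.le), Set.projIcc_of_mem hT (hmem (k + 1) hk)]
    rw [hR, abs_sub_comm]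
    refine (abs_riemannSum_sub_pathIntegral_le hγ ha hst htτ (hx ω).2 n.succ_ne_zero
      (hx ω).1).trans (le_of_eq ?_)
    simp only [hε]
    ring
  have hIL : ∀ n, MemLp (I n) 2 P := fun n => memLp_stepIntegral hb _
  -- Measurability of the pathwise integral is inherited from the step integrals, of which it is an
  -- almost sure limit.
  have hXm : AEStronglyMeasurable X P := by
    refine aestronglyMeasurable_of_tendsto_ae atTop (fun n => (hIL n).1) ?_
    filter_upwards [ae_all_iff.2 hbd] with ω hω
    rw [tendsto_iff_norm_sub_tendsto_zero]
    refine squeeze_zero (fun _ => norm_nonneg _) (fun n => ?_)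
      (by simpa using hεlim.mul_const (K ω))
    rw [norm_sub_rev]
    exact hω n
  have hXI : ∀ n, eLpNorm (X - I n) 2 P ≤ ENNReal.ofReal (ε n) * eLpNorm K 2 P := by
    intro n
    have hε0 : 0 ≤ ε n := mul_nonneg (Real.rpow_nonneg
      (div_nonneg (sub_nonneg.2 hst) (Nat.cast_nonneg _)) _) (by positivity)
    refine eLpNorm_le_mul_eLpNorm_of_ae_le_mul ?_ 2
    filter_upwards [hbd n] with ω hω
    rw [Real.norm_of_nonneg (hx ω).1]
    exact hω
  refine ⟨(boundedOn_kernel hγ htτ).memAbsH hH, ?_,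
    fun n => riemannStep hT γ s t τ (n + 1), ?_, ?_⟩
  · have h0 : MemLp (X - I 0) 2 P :=
      ⟨hXm.sub (hIL 0).1, (hXI 0).trans_lt
        (ENNReal.mul_lt_top ENNReal.ofReal_lt_top hK.eLpNorm_lt_top)⟩
    simpa using h0.add (hIL 0)
  · set E : ℝ := H * (2 * H - 1) * (∫ p : ℝ × ℝ, |p.2 - p.1| ^ (2 * H - 2)
      ∂(intervalMeasure T).prod (intervalMeasure T))
    set δ : ℕ → ℝ := fun n => (t - s) / ((n + 1 : ℕ) : ℝ) * (τ - t) ^ (-γ - 1) with hδ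
    have hδlim : Tendsto δ atTop (𝓝 0) := by
      have := hmesh.mul_const ((τ - t) ^ (-γ - 1))
      rwa [zero_mul] at this
    have hlim : Tendsto (fun n => E * (δ n * δ n)) atTop (𝓝 0) := by
      simpa using (hδlim.mul hδlim).const_mul E
    refine squeeze_zero_norm (fun n => ?_) hlim
    obtain ⟨M, hM⟩ := exists_boundedOn_stepFun (riemannStep hT γ s t τ (n + 1))
    have hd : BoundedOn T (δ n) (kernel γ s t τ - stepFun (riemannStep hT γ s t τ (n + 1))) :=
      ⟨(boundedOn_kernel hγ htτ).1.sub hM.1,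
        ae_abs_kernel_sub_stepFun_le hT hγ hγ1 hs hst htτ ht n.succ_ne_zero⟩
    exact hd.abs_innerH_le hd hH
  · refine tendsto_of_tendsto_of_tendsto_of_le_of_le tendsto_const_nhds ?_ (fun _ => zero_le) hXI
    have := ENNReal.Tendsto.mul_const (ENNReal.tendsto_ofReal hεlim)
      (Or.inr hK.eLpNorm_lt_top.ne)
    simpa using this

end

/-! ### Suprema of continuous functions over countable dense subsets -/

lemma biSup_eq_of_subset_closure {X : Type*} [TopologicalSpace X] {S D : Set X} {f : X → ℝ≥0∞}
    (hf : ContinuousOn f S) (hDS : D ⊆ S) (hSD : S ⊆ closure D) :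
    ⨆ x ∈ S, f x = ⨆ x ∈ D, f x := by
  refine le_antisymm (iSup₂_le fun x hx => ?_) (biSup_mono hDS)
  have h1 : f x ∈ closure (f '' D) :=
    ((hf x hx).mono hDS).mem_closure_image (hSD hx)
  have h2 : f '' D ⊆ Set.Iic (⨆ x ∈ D, f x) :=
    Set.image_subset_iff.2 fun y hy => le_iSup₂ (f := fun x (_ : x ∈ D) => f x) y hy
  exact closure_minimal h2 isClosed_Iic h1

lemma exists_countable_subset_closure {X : Type*} [TopologicalSpace X]
    [TopologicalSpace.PseudoMetrizableSpace X] [SecondCountableTopology X] (S : Set X) :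
    ∃ D ⊆ S, D.Countable ∧ S ⊆ closure D :=
  (TopologicalSpace.IsSeparable.of_separableSpace S).exists_countable_dense_subset

/-- Division in `ℝ≥0∞` is not jointly continuous, but a positive real denominator allows the
quotient to be formed in `ℝ` first. -/
lemma continuousOn_enorm_div {X E : Type*} [TopologicalSpace X] [NormedAddCommGroup E] {S : Set X}
    {f : X → E} {g : X → ℝ} (hf : ContinuousOn f S) (hg : ContinuousOn g S)
    (hpos : ∀ x ∈ S, 0 < g x) : ContinuousOn (fun x => ‖f x‖ₑ / ENNReal.ofReal (g x)) S := by
  have h : ContinuousOn (fun x => ENNReal.ofReal (‖f x‖ / g x)) S :=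
    ENNReal.continuous_ofReal.comp_continuousOn (hf.norm.div hg fun x hx => (hpos x hx).ne')
  refine h.congr fun x hx => ?_
  simp only [ENNReal.ofReal_div_of_pos (hpos x hx), ofReal_norm]

lemma psi1_pos {T α γ : ℝ} {x : ℝ × ℝ × ℝ} (hx : x ∈ simplex3 T) :
    0 < psi1 α γ x.2.2 x.2.1 x.1 := by
  rw [psi1_eq hx.2.1 hx.2.2.1]
  exact kernelBound_pos hx.2.1 hx.2.2.1

lemma psi12_pos {T α γ η ζ : ℝ} {x : ℝ × ℝ × ℝ × ℝ} (hx : x ∈ simplex4 T) :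
    0 < psi12 α γ η ζ x.2.2.2 x.2.2.1 x.2.1 x.1 := by
  obtain ⟨-, h1, h2, h3, -⟩ := hx
  rw [psi12_eq h1 h2 h3]
  have := sub_pos.2 h2
  have := sub_pos.2 h3
  have := kernelBound_pos (α := α) (q := γ + ζ) h1 h2
  positivity

lemma continuousOn_psi1 (T α γ : ℝ) :
    ContinuousOn (fun x : ℝ × ℝ × ℝ => psi1 α γ x.2.2 x.2.1 x.1) (simplex3 T) := by
  have h1 : ∀ p : ℝ, ContinuousOn (fun x : ℝ × ℝ × ℝ => |x.2.2 - x.2.1| ^ p) (simplex3 T) :=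
    fun p => ContinuousOn.rpow_const (by fun_prop) fun x hx =>
      Or.inl (abs_ne_zero.2 (sub_pos.2 hx.2.2.1).ne')
  have h2 : ∀ p : ℝ, ContinuousOn (fun x : ℝ × ℝ × ℝ => |x.2.1 - x.1| ^ p) (simplex3 T) :=
    fun p => ContinuousOn.rpow_const (by fun_prop) fun x hx =>
      Or.inl (abs_ne_zero.2 (sub_pos.2 hx.2.1).ne')
  exact ((h1 _).mul (h2 _)).inf (h2 _)

lemma continuousOn_psi12 (T α γ η ζ : ℝ) :
    ContinuousOn (fun x : ℝ × ℝ × ℝ × ℝ => psi12 α γ η ζ x.2.2.2 x.2.2.1 x.2.1 x.1)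
      (simplex4 T) := by
  have h0 : ∀ p : ℝ, ContinuousOn (fun x : ℝ × ℝ × ℝ × ℝ => |x.2.2.2 - x.2.2.1| ^ p)
      (simplex4 T) := fun p => ContinuousOn.rpow_const (by fun_prop) fun x hx =>
      Or.inl (abs_ne_zero.2 (sub_pos.2 hx.2.2.2.1).ne')
  have h1 : ∀ p : ℝ, ContinuousOn (fun x : ℝ × ℝ × ℝ × ℝ => |x.2.2.1 - x.2.1| ^ p)
      (simplex4 T) := fun p => ContinuousOn.rpow_const (by fun_prop) fun x hx =>
      Or.inl (abs_ne_zero.2 (sub_pos.2 hx.2.2.1).ne')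
  have h2 : ∀ p : ℝ, ContinuousOn (fun x : ℝ × ℝ × ℝ × ℝ => |x.2.1 - x.1| ^ p)
      (simplex4 T) := fun p => ContinuousOn.rpow_const (by fun_prop) fun x hx =>
      Or.inl (abs_ne_zero.2 (sub_pos.2 hx.2.1).ne')
  exact ((h0 _).mul (h1 _)).mul (((h1 _).mul (h2 _)).inf (h2 _))

lemma mem_simplex3_right {T : ℝ} {x : ℝ × ℝ × ℝ × ℝ} (hx : x ∈ simplex4 T) :
    (x.1, x.2.1, x.2.2.2) ∈ simplex3 T :=
  ⟨hx.1, hx.2.1, hx.2.2.1.trans hx.2.2.2.1, hx.2.2.2.2⟩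

lemma mem_simplex3_left {T : ℝ} {x : ℝ × ℝ × ℝ × ℝ} (hx : x ∈ simplex4 T) :
    (x.1, x.2.1, x.2.2.1) ∈ simplex3 T :=
  ⟨hx.1, hx.2.1, hx.2.2.1, hx.2.2.2.1.le.trans hx.2.2.2.2⟩

/-- Where the path is continuous, both quotients are continuous on their simplices, so the suprema
may be taken over countable dense subsets. -/
lemma aemeasurable_volterraNorm {Ω : Type*} [MeasurableSpace Ω] {P : Measure Ω} {m : ℕ}
    {z : Ω → ℝ → ℝ → ℝ → EuclideanSpace ℝ (Fin m)} (T α γ η ζ : ℝ)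
    (hm : ∀ s t τ, (s, t, τ) ∈ simplex3 T → AEMeasurable (fun ω => z ω s t τ) P)
    (hc : ∀ᵐ ω ∂P,
      ContinuousOn (fun x : ℝ × ℝ × ℝ => z ω x.1 x.2.1 x.2.2) (simplex3 T)) :
    AEMeasurable (fun ω => volterraNorm T α γ η ζ (z ω)) P := by
  obtain ⟨D, hDS, hDc, hSD⟩ := exists_countable_subset_closure (simplex3 T)
  obtain ⟨D', hDS', hDc', hSD'⟩ := exists_countable_subset_closure (simplex4 T)
  have h1 : AEMeasurable (fun ω => ⨆ x ∈ D, ‖z ω x.1 x.2.1 x.2.2‖ₑ /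
      ENNReal.ofReal (psi1 α γ x.2.2 x.2.1 x.1)) P :=
    AEMeasurable.biSup D hDc fun x hx => (hm _ _ _ (hDS hx)).enorm.div_const _
  have h2 : AEMeasurable (fun ω => ⨆ x ∈ D', ‖z ω x.1 x.2.1 x.2.2.2 - z ω x.1 x.2.1 x.2.2.1‖ₑ /
      ENNReal.ofReal (psi12 α γ η ζ x.2.2.2 x.2.2.1 x.2.1 x.1)) P :=
    AEMeasurable.biSup D' hDc' fun x hx =>
      ((hm _ _ _ (mem_simplex3_right (hDS' hx))).sub
        (hm _ _ _ (mem_simplex3_left (hDS' hx)))).enorm.div_const _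
  refine (h1.add h2).congr ?_
  filter_upwards [hc] with ω hω
  have c1 := continuousOn_enorm_div hω (continuousOn_psi1 T α γ) fun x hx => psi1_pos hx
  have c2 : ContinuousOn (fun x : ℝ × ℝ × ℝ × ℝ =>
      z ω x.1 x.2.1 x.2.2.2 - z ω x.1 x.2.1 x.2.2.1) (simplex4 T) := by
    refine ContinuousOn.sub ?_ ?_
    · exact hω.comp (f := fun x : ℝ × ℝ × ℝ × ℝ => (x.1, x.2.1, x.2.2.2)) (by fun_prop)
        fun x hx => mem_simplex3_right hx
    · exact hω.comp (f := fun x : ℝ × ℝ × ℝ × ℝ => (x.1, x.2.1, x.2.2.1)) (by fun_prop)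
        fun x hx => mem_simplex3_left hx
  have c3 := continuousOn_enorm_div c2 (continuousOn_psi12 T α γ η ζ) fun x hx => psi12_pos hx
  simp only [Pi.add_apply, volterraNorm, volterraNorm1, volterraNorm12]
  rw [biSup_eq_of_subset_closure c1 hDS hSD, biSup_eq_of_subset_closure c3 hDS' hSD']

lemma euclidean_norm_le_sum {m : ℕ} (v : EuclideanSpace ℝ (Fin m)) : ‖v‖ ≤ ∑ i, |v i| := by
  rw [EuclideanSpace.norm_eq, Real.sqrt_le_left (Finset.sum_nonneg fun _ _ => abs_nonneg _)]
  exact Finset.sum_sq_le_sq_sum_of_nonneg fun i _ => abs_nonneg _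

lemma volterraNorm_le {m : ℕ} {T α γ η ζ C C' : ℝ} {K : Fin m → ℝ}
    {z : ℝ → ℝ → ℝ → EuclideanSpace ℝ (Fin m)}
    (h1 : ∀ s t τ, (s, t, τ) ∈ simplex3 T → ∀ i,
      |z s t τ i| ≤ C * (K i * psi1 α γ τ t s))
    (h2 : ∀ s t τ' τ, (s, t, τ', τ) ∈ simplex4 T → ∀ i,
      |z s t τ i - z s t τ' i| ≤ C' * (K i * psi12 α γ η ζ τ τ' t s)) :
    volterraNorm T α γ η ζ z ≤ ENNReal.ofReal (C * ∑ i, K i) + ENNReal.ofReal (C' * ∑ i, K i) := by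
  have key : ∀ (v : EuclideanSpace ℝ (Fin m)) (C ψ : ℝ), 0 < ψ →
      (∀ i, |v i| ≤ C * (K i * ψ)) →
      ‖v‖ₑ / ENNReal.ofReal ψ ≤ ENNReal.ofReal (C * ∑ i, K i) := by
    intro v C ψ hψ hv
    rw [← ofReal_norm, ← ENNReal.ofReal_div_of_pos hψ]
    refine ENNReal.ofReal_le_ofReal ?_
    rw [div_le_iff₀ hψ]
    refine (euclidean_norm_le_sum v).trans ((Finset.sum_le_sum fun i _ => hv i).trans
      (le_of_eq ?_))
    rw [← Finset.mul_sum, ← Finset.sum_mul, mul_assoc]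
  refine add_le_add (iSup₂_le fun x hx => ?_) (iSup₂_le fun x hx => ?_)
  · exact key _ _ _ (psi1_pos hx) (h1 _ _ _ hx)
  · exact key _ _ _ (psi12_pos hx) (h2 _ _ _ _ hx)

/-! ### The first level of the Volterra rough path -/

section

variable {Ω : Type*} [MeasurableSpace Ω] {P : Measure Ω} {H T γ : ℝ} {m : ℕ}
  {B : Set.Icc (0 : ℝ) T → Ω → EuclideanSpace ℝ (Fin m)}
  {z z' : Ω → ℝ → ℝ → ℝ → EuclideanSpace ℝ (Fin m)}

lemma IsFBM.hasFBMCovariance [IsProbabilityMeasure P] (hB : IsFBM P H T B) (i : Fin m) :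
    HasFBMCovariance P H (fun t ω => B t ω i) :=
  ⟨hB.memLp_coord i, hB.integral_mul i⟩

lemma IsFirstLevel.aemeasurable (hz : IsFirstLevel P H T γ B z) {s t τ : ℝ}
    (hx : (s, t, τ) ∈ simplex3 T) : AEMeasurable (fun ω => z ω s t τ) P := by
  have h : AEMeasurable (fun ω i => z ω s t τ i) P :=
    aemeasurable_pi_iff.2 fun i => (hz.wiener s t τ hx i).2.1.1.aemeasurable
  exact (PiLp.continuous_toLp 2 fun _ : Fin m => ℝ).measurable.comp_aemeasurable h

/-- Two continuous versions of the first level are indistinguishable. -/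
lemma IsFirstLevel.ae_eq [IsProbabilityMeasure P] (hB : IsFBM P H T B) (hH : 1 / 2 < H)
    (hγ : 0 < γ) (hγ1 : γ ≤ 1) (hz : IsFirstLevel P H T γ B z) (hz' : IsFirstLevel P H T γ B z') :
    ∀ᵐ ω ∂P, ∀ s t τ, (s, t, τ) ∈ simplex3 T → z ω s t τ = z' ω s t τ := by
  obtain ⟨D, hDS, hDc, hSD⟩ := exists_countable_subset_closure (simplex3 T)
  -- Uniqueness of the Wiener integral gives one null set per triple; countability of `D` merges
  -- them, and continuity extends the equality to the simplex.
  have hD : ∀ᵐ ω ∂P, ∀ x ∈ D, z ω x.1 x.2.1 x.2.2 = z' ω x.1 x.2.1 x.2.2 := by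
    refine (ae_ball_iff hDc).2 fun x hx => ?_
    obtain ⟨h0, h1, h2, h3⟩ := hDS hx
    have hi : ∀ i, ∀ᵐ ω ∂P, z ω x.1 x.2.1 x.2.2 i = z' ω x.1 x.2.1 x.2.2 i := fun i =>
      (hz.wiener _ _ _ (hDS hx) i).ae_eq (hB.hasFBMCovariance i) hH (boundedOn_kernel hγ h2)
        (stepApproximable_kernel hγ hγ1 h0 h1.le h2 (h2.le.trans h3))
        (hz'.wiener _ _ _ (hDS hx) i)
    filter_upwards [ae_all_iff.2 hi] with ω hω
    ext i
    exact hω i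
  filter_upwards [hD, hz.continuous, hz'.continuous] with ω h hc hc'
  have heq := Set.EqOn.of_subset_closure
    (f := fun x : ℝ × ℝ × ℝ => z ω x.1 x.2.1 x.2.2)
    (g := fun x : ℝ × ℝ × ℝ => z' ω x.1 x.2.1 x.2.2) h hc hc' hDS hSD
  exact fun s t τ hx => heq hx

lemma memLp_of_lintegral_ofReal_rpow {K : Ω → ℝ} (hm : AEMeasurable K P) (h0 : ∀ ω, 0 ≤ K ω)
    (hK : ∀ q : ℝ, 0 ≤ q → ∫⁻ ω, ENNReal.ofReal (K ω) ^ q ∂P < ∞) {q : ℝ≥0∞} (hq0 : q ≠ 0)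
    (hq : q ≠ ∞) : MemLp K q P := by
  refine ⟨hm.aestronglyMeasurable, ?_⟩
  rw [eLpNorm_lt_top_iff_lintegral_rpow_enorm_lt_top hq0 hq]
  simp only [Real.enorm_of_nonneg (h0 _)]
  exact hK _ ENNReal.toReal_nonneg

lemma isFirstLevel_pathIntegral [IsProbabilityMeasure P] (hB : IsFBM P H T B) (hH : 1 / 2 < H)
    (hγ : 0 < γ) (hγ1 : γ ≤ 1) {a : ℝ} (ha : 0 < a) {x : Fin m → Ω → ℝ → ℝ} {K : Fin m → Ω → ℝ}
    (hx : ∀ i ω, 0 ≤ K i ω ∧ HolderBound (K i ω) a (x i ω))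
    (hxB : ∀ i, ∀ t : Set.Icc (0 : ℝ) T, (fun ω => x i ω t) =ᵐ[P] fun ω => B t ω i)
    (hK : ∀ i, MemLp (K i) 2 P) :
    IsFirstLevel P H T γ B
      (fun ω s t τ => WithLp.toLp 2 fun i => pathIntegral γ (x i ω) s t τ) where
  wiener _ _ _ hs i := isWienerIntegral_pathIntegral (hB.hasFBMCovariance i) hH ha (hx i) (hxB i)
    (hK i) hγ hγ1 hs.1 hs.2.1.le hs.2.2.1 (hs.2.2.1.le.trans hs.2.2.2)
  continuous := ae_of_all _ fun ω =>
    (PiLp.continuous_toLp 2 fun _ : Fin m => ℝ).comp_continuousOn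
      (continuousOn_pi.2 fun i => continuousOn_pathIntegral ((hx i ω).2.continuous ha))

end

end VolterraFBM

/-! ### Proof of the theorem. -/

open VolterraFBM in
theorem mainTheorem6 {Ω : Type*} [MeasurableSpace Ω] (P : Measure Ω) [IsProbabilityMeasure P]
    (m : ℕ) (T H α γ : ℝ) (hT : 0 < T)
    (hH : H ∈ Set.Ioo (1 / 2 : ℝ) 1) (hα : α ∈ Set.Ioo 0 H) (hγ : γ ∈ Set.Ioo 0 (2 * H - 1))
    (hρ : 0 < α - γ)
    (N : ℕ) (η ζ : Fin N → ℝ)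
    (hη : ∀ k, η k ∈ Set.Icc (0 : ℝ) 1)
    (hζ : ∀ k, 0 ≤ ζ k ∧ ζ k ≤ min (α - γ) (η k)) (hηα : ∀ k, 1 - α < η k)
    (B : Set.Icc (0 : ℝ) T → Ω → EuclideanSpace ℝ (Fin m)) (hB : VolterraFBM.IsFBM P H T B) :
    (∃ z, VolterraFBM.IsFirstLevel P H T γ B z) ∧
    ∀ z, VolterraFBM.IsFirstLevel P H T γ B z →
      (∀ᵐ ω ∂P, ∀ k, z ω ∈
        VolterraFBM.volterraSpace (EuclideanSpace ℝ (Fin m)) T α γ (η k) (ζ k)) ∧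
      ∀ k, AEMeasurable (fun ω => VolterraFBM.volterraNorm T α γ (η k) (ζ k) (z ω)) P ∧
        ∀ p : ℝ, 1 ≤ p →
          ∫⁻ ω, VolterraFBM.volterraNorm T α γ (η k) (ζ k) (z ω) ^ (2 * p) ∂P < ∞ := by
  have hH' := hH.1
  have hγ0 := hγ.1
  have hγ1 : γ ≤ 1 := by linarith [hγ.2, hH.2]
  -- Kolmogorov's criterion needs `a < H`. The strict inequality `α < a` gives `γ + ζ < a` even in
  -- the extreme case `ζ = α - γ`; its price is the factor `T^{a-α}`.
  obtain ⟨a, hαa, haH⟩ := exists_between hα.2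
  have ha : 0 < a := hα.1.trans hαa
  have hversion := fun i => exists_holder_version hT
    (fun t => (hB.memLp_coord i t).1.aemeasurable) (hB.momentBound (by linarith) i) ha haH
  choose x K hx hxB hKm hK using hversion
  have hKL : ∀ (q : ℝ≥0∞), q ≠ 0 → q ≠ ∞ → ∀ i, MemLp (K i) q P := fun q hq0 hq i =>
    memLp_of_lintegral_ofReal_rpow (hKm i) (fun ω => (hx i ω).1) (hK i) hq0 hq
  have hz₀ := isFirstLevel_pathIntegral hB hH' hγ0 hγ1 ha hx hxB
    (hKL 2 two_ne_zero ENNReal.ofNat_ne_top)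
  refine ⟨⟨_, hz₀⟩, fun z hz => ?_⟩
  have hle : ∀ k, ∃ C C' : ℝ, ∀ᵐ ω ∂P, volterraNorm T α γ (η k) (ζ k) (z ω) ≤
      ENNReal.ofReal (C * ∑ i, K i ω) + ENNReal.ofReal (C' * ∑ i, K i ω) := by
    intro k
    obtain ⟨hζ0, hζ1⟩ := hζ k
    have hζρ := hζ1.trans (min_le_left _ _)
    have hζη := hζ1.trans (min_le_right _ _)
    refine ⟨(1 + 1 / γ + 1 / (a - γ)) * T ^ (a - α),
      2 * (1 + 1 / (γ + ζ k) + 1 / (a - (γ + ζ k))) * T ^ (a - α), ?_⟩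
    filter_upwards [hz.ae_eq hB hH' hγ0 hγ1 hz₀] with ω hω
    refine volterraNorm_le (fun s t τ hs i => ?_) fun s t τ' τ hs i => ?_
    · rw [hω s t τ hs]
      obtain ⟨h0, h1, h2, h3⟩ := hs
      dsimp only at h0 h1 h2 h3
      exact abs_pathIntegral_le h1 h2 (by linarith) hγ0 hγ1 (by linarith) hαa.le (hx i ω).2
    · rw [hω s t τ (mem_simplex3_right hs), hω s t τ' (mem_simplex3_left hs)]
      obtain ⟨h0, h1, h2, h3, h4⟩ := hs
      dsimp only at h0 h1 h2 h3 h4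
      exact abs_pathIntegral_sub_le h1 h2 h3 (by linarith) hγ0 hγ1 (hη k).1 (hη k).2 hζ0 hζη
        (by linarith) hαa.le (hx i ω).2
  refine ⟨ae_all_iff.2 fun k => ?_, fun k => ⟨?_, fun p hp => ?_⟩⟩
  · obtain ⟨C, C', hCC⟩ := hle k
    filter_upwards [hCC] with ω hω
    exact hω.trans_lt (ENNReal.add_lt_top.2 ⟨ENNReal.ofReal_lt_top, ENNReal.ofReal_lt_top⟩)
  · exact aemeasurable_volterraNorm T α γ (η k) (ζ k) (fun s t τ hs => hz.aemeasurable hs)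
      hz.continuous
  · obtain ⟨C, C', hCC⟩ := hle k
    have hq : (0 : ℝ) < 2 * p := by linarith
    -- The signs of `C` and `C'` were not recorded, so absolute values provide a nonnegative
    -- dominating variable.
    have hmem : MemLp (fun ω => (|C| + |C'|) * ∑ i, K i ω) (ENNReal.ofReal (2 * p)) P :=
      (memLp_finsetSum _ fun i _ =>
        hKL _ (by simpa using hq) ENNReal.ofReal_ne_top i).const_mul _
    have hfin := lintegral_rpow_enorm_lt_top_of_eLpNorm_lt_top (by simpa using hq)
      ENNReal.ofReal_ne_top hmem.eLpNorm_lt_top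
    rw [ENNReal.toReal_ofReal hq.le] at hfin
    refine lt_of_le_of_lt (lintegral_mono_ae ?_) hfin
    filter_upwards [hCC] with ω hω
    have hS : 0 ≤ ∑ i, K i ω := Finset.sum_nonneg fun i _ => (hx i ω).1
    refine ENNReal.rpow_le_rpow (hω.trans ?_) hq.le
    rw [Real.enorm_of_nonneg (by positivity), add_mul, ENNReal.ofReal_add (by positivity)
      (by positivity)]
    gcongr <;> exact le_abs_self _
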